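/- All graphs are finite and simple. The double star $S_{2,4}$ is the graph obtained from an edge $uv$ by attaching $2$ pendant vertices to $u$ and $4$ pendant vertices to $v$ (so it has $8$ vertices and $7$ edges). A graph is $S_{2,4}$-free if it does not contain $S_{2,4}$ as a (not necessarily induced) subgraph. (i) Every planar $S_{2,4}$-free graph $G$ on $n$ vertices satisfies $e(G)\le \frac{31}{14}\,n$. (ii) For every $n$ divisible by $14$ there is a planar $S_{2,4}$-free graph on $n$ vertices with exactly $\frac{31}{14}\,n$ edges. (iii) For every $n\ge 14$ with $n\equiv 8 \pmod{14}$ there is a planar $S_{2,4}$-free graph on $n$ vertices with exactly $\lfloor \frac{31}{14}\,n\rfloor$ edges. -/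

import Mathlib

/-- The double star `S_{k,l}`: an edge joining the two centres `Sum.inl none` and `Sum.inr none`,
with `k` leaves `Sum.inl (some i)` attached to the first centre and `l` leaves
`Sum.inr (some j)` attached to the second one. -/
def doubleStar (k l : ℕ) : SimpleGraph (Option (Fin k) ⊕ Option (Fin l)) :=
  SimpleGraph.fromRel fun x y =>
    (x = Sum.inl none ∧ y = Sum.inr none) ∨
    (x = Sum.inl none ∧ ∃ i : Fin k, y = Sum.inl (some i)) ∨
    (x = Sum.inr none ∧ ∃ j : Fin l, y = Sum.inr (some j))

/-- `S` is a (simple) polygonal arc in the plane `ℝ × ℝ` with end points `x` and `y`: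
the union of `m ≥ 1` nondegenerate segments `[p 0, p 1], …, [p (m - 1), p m]` with `p 0 = x` and
`p m = y`, where consecutive segments meet only in their common end point, and segments that are
not consecutive are disjoint. Values `p i` with `i > m` play no role. -/
def IsPolygonalArc (S : Set (ℝ × ℝ)) (x y : ℝ × ℝ) : Prop :=
  ∃ (m : ℕ) (p : ℕ → ℝ × ℝ), 1 ≤ m ∧ p 0 = x ∧ p m = y ∧
    (∀ i, i < m → p i ≠ p (i + 1)) ∧
    (∀ i, i + 1 < m →
      segment ℝ (p i) (p (i + 1)) ∩ segment ℝ (p (i + 1)) (p (i + 2)) = {p (i + 1)}) ∧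
    (∀ i j, i + 1 < j → j < m →
      Disjoint (segment ℝ (p i) (p (i + 1))) (segment ℝ (p j) (p (j + 1)))) ∧
    S = ⋃ i ∈ Finset.range m, segment ℝ (p i) (p (i + 1))

/-- A drawing of the graph `G` in the plane without crossings: the vertices are distinct points,
every edge is a polygonal arc between its two end vertices, an edge passes through no vertex
other than its ends, and two different edges meet only in common end vertices.
Values of `curve` outside the edge set of `G` play no role. -/
structure PlaneDrawing {V : Type*} (G : SimpleGraph V) where
  /-- the point that represents a vertex -/
  point : V → ℝ × ℝ
  /-- the set of points of the arc that represents an edge -/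
  curve : Sym2 V → Set (ℝ × ℝ)
  point_injective : Function.Injective point
  isPolygonalArc_curve : ∀ u v : V, G.Adj u v →
    IsPolygonalArc (curve s(u, v)) (point u) (point v)
  mem_of_point_mem : ∀ e ∈ G.edgeSet, ∀ w : V, point w ∈ curve e → w ∈ e
  curve_inter_subset : ∀ e ∈ G.edgeSet, ∀ f ∈ G.edgeSet, e ≠ f →
    curve e ∩ curve f ⊆ point '' {w | w ∈ e ∧ w ∈ f}

/-- A graph is planar if it has a drawing in the plane without crossings. -/
def IsPlanarGraph {V : Type*} (G : SimpleGraph V) : Prop :=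
  Nonempty (PlaneDrawing G)

/-! Upper bound. Planarity enters only through a parity invariant; neither faces nor the Jordan
curve theorem are needed. For two disjoint polygonal arcs, count the ends of each that lie below the
other, as seen by vertical rays. The parity of this number depends only on the lexicographic order
of the four ends. `HasEvenCrossings` records this for edges without common ends. It passes to
subgraphs, and adding its equations over suitable pairs of edges gives `0 = 1` for `K₅`, for `K₃₃`
and for `K₃₃` with one subdivided edge. Nothing else about planarity is used.

The inequality `7 * ∑ deg ≤ 31 * n` is proved by induction on `n`. A vertex of degree at most 2 can
be deleted. A vertex of degree at least 7 has only neighbours of degree at most 2. If all degrees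
are at least 3, a vertex of degree 6 and its neighbours form a whole component, and its
neighbourhood induces at most nine edges, so this component can be deleted too.

There remain graphs with degrees 3, 4 and 5 (`IsReduced`), which are treated by discharging. The
charge `31 - 7 * deg` is `-4` at degree 5 and at least `3` elsewhere, and the claim is that the
total is nonnegative. Adjacency is transitive among vertices of degree 5, so these split into
cliques, the clusters, of at most four vertices. Every other vertex shares its charge evenly among
its neighbours of degree 5. A cluster of one vertex receives at least `3 / 2` from each of five
neighbours. A larger cluster shares no boundary vertex with another cluster, and its boundary has
charge at least 12, 12, 16 for 2, 3, 4 vertices. So each cluster receives at least 4 per vertex.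

Constructions. An octahedron with a vertex inserted into a face has 7 vertices and 15 edges, and the
inserted vertex can take one more edge. Two of these joined by an edge give 14 vertices and 31
edges; three joined to a new vertex give 22 and 48. Disjoint unions give the rest. -/

/-! ### Orientations and disjoint segments -/

/-- The orientation of a triple of points. It is positive if `r` lies to the left of the line
from `p` to `q`. -/
def orient (p q r : ℝ × ℝ) : ℝ := (q.1 - p.1) * (r.2 - p.2) - (q.2 - p.2) * (r.1 - p.1)

/-- The strict lexicographic order on the plane. -/
def LexLT (p q : ℝ × ℝ) : Prop := p.1 < q.1 ∨ p.1 = q.1 ∧ p.2 < q.2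

theorem LexLT.trans {p q r : ℝ × ℝ} (h₁ : LexLT p q) (h₂ : LexLT q r) : LexLT p r := by
  unfold LexLT at *
  rcases h₁ with h₁ | ⟨h₁, h₁'⟩ <;> rcases h₂ with h₂ | ⟨h₂, h₂'⟩
  · exact .inl (h₁.trans h₂)
  · exact .inl (h₂ ▸ h₁)
  · exact .inl (h₁ ▸ h₂)
  · exact .inr ⟨h₁.trans h₂, h₁'.trans h₂'⟩

theorem LexLT.asymm {p q : ℝ × ℝ} (h₁ : LexLT p q) : ¬ LexLT q p := by
  unfold LexLT at *
  rintro (h | ⟨h, h'⟩) <;> rcases h₁ with h₁ | ⟨h₁, h₁'⟩ <;> linarith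

theorem lexLT_or_lexLT {p q : ℝ × ℝ} (h : p ≠ q) : LexLT p q ∨ LexLT q p := by
  unfold LexLT
  rcases lt_trichotomy p.1 q.1 with h₁ | h₁ | h₁
  · exact .inl (.inl h₁)
  · rcases lt_trichotomy p.2 q.2 with h₂ | h₂ | h₂
    · exact .inl (.inr ⟨h₁, h₂⟩)
    · exact absurd (Prod.ext h₁ h₂) h
    · exact .inr (.inr ⟨h₁.symm, h₂⟩)
  · exact .inr (.inl h₁)

/-- If a positive combination of lexicographically positive vectors is a multiple of such a
vector, then the factor is positive. -/
theorem pos_of_lexLT_comb {p q r s t u : ℝ × ℝ} {a b c : ℝ} (ha : 0 < a) (hb : 0 < b)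
    (h₁ : LexLT p q) (h₂ : LexLT r s) (h₃ : LexLT t u)
    (e₁ : a * (q.1 - p.1) + b * (s.1 - r.1) = c * (u.1 - t.1))
    (e₂ : a * (q.2 - p.2) + b * (s.2 - r.2) = c * (u.2 - t.2)) : 0 < c := by
  by_contra! hc
  unfold LexLT at *
  have key : ∀ {x y : ℝ}, 0 ≤ x → 0 ≤ y → a * x + b * y ≤ 0 → x = 0 ∧ y = 0 := by
    intro x y hx hy h
    have h1 : 0 ≤ a * x := by positivity
    have h2 : 0 ≤ b * y := by positivity
    have h3 : a * x = 0 := by linarith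
    have h4 : b * y = 0 := by linarith
    exact ⟨by simpa [ha.ne'] using h3, by simpa [hb.ne'] using h4⟩
  have n₁ : 0 ≤ q.1 - p.1 := by rcases h₁ with h | h <;> linarith
  have n₂ : 0 ≤ s.1 - r.1 := by rcases h₂ with h | h <;> linarith
  have n₃ : 0 ≤ u.1 - t.1 := by rcases h₃ with h | h <;> linarith
  obtain ⟨z₁, z₂⟩ := key n₁ n₂ (by rw [e₁]; exact mul_nonpos_of_nonpos_of_nonneg hc n₃)
  have m₁ : 0 < q.2 - p.2 := by rcases h₁ with h | h <;> linarith
  have m₂ : 0 < s.2 - r.2 := by rcases h₂ with h | h <;> linarith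
  rw [z₁, z₂] at e₁
  rcases h₃ with h | h
  · have hc0 : c = 0 := by
      have : c * (u.1 - t.1) = 0 := by linarith
      rcases mul_eq_zero.1 this with h' | h' <;> linarith
    subst hc0
    obtain ⟨z₁, z₂⟩ := key m₁.le m₂.le (by rw [e₂]; simp)
    linarith
  · obtain ⟨z₁, z₂⟩ := key m₁.le m₂.le
      (by rw [e₂]; exact mul_nonpos_of_nonpos_of_nonneg hc (by linarith))
    linarith

theorem mem_segment_of_comb {p q x : ℝ × ℝ} {a b : ℝ} (ha : 0 ≤ a) (hb : 0 ≤ b) (hab : 0 < a + b)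
    (e₁ : (a + b) * x.1 = a * p.1 + b * q.1) (e₂ : (a + b) * x.2 = a * p.2 + b * q.2) :
    x ∈ segment ℝ p q := by
  refine ⟨a / (a + b), b / (a + b), by positivity, by positivity, by field_simp, ?_⟩
  ext
  · simp only [Prod.fst_add, Prod.smul_fst, smul_eq_mul]
    field_simp
    linarith
  · simp only [Prod.snd_add, Prod.smul_snd, smul_eq_mul]
    field_simp
    linarith

theorem mem_segment_of_orient_eq_zero {p q r : ℝ × ℝ} (h₁ : LexLT p r) (h₂ : LexLT r q)
    (h : orient p q r = 0) : r ∈ segment ℝ p q := by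
  unfold orient at h
  unfold LexLT at h₁ h₂
  rcases lt_or_eq_of_le (show p.1 ≤ q.1 by
    rcases h₁ with h₁ | h₁ <;> rcases h₂ with h₂ | h₂ <;> linarith) with hpq | hpq
  · refine mem_segment_of_comb (a := q.1 - r.1) (b := r.1 - p.1) ?_ ?_ ?_ ?_ ?_
    · rcases h₂ with h₂ | h₂ <;> linarith
    · rcases h₁ with h₁ | h₁ <;> linarith
    · linarith
    · ring
    · linarith
  · have h₃ : p.1 = r.1 := by rcases h₁ with h₁ | h₁ <;> rcases h₂ with h₂ | h₂ <;> linarith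
    refine mem_segment_of_comb (a := q.2 - r.2) (b := r.2 - p.2) ?_ ?_ ?_ ?_ ?_
    · rcases h₂ with h₂ | h₂ <;> linarith
    · rcases h₁ with h₁ | h₁ <;> linarith
    · rcases h₁ with h₁ | h₁ <;> rcases h₂ with h₂ | h₂ <;> linarith
    · rw [← hpq, ← h₃]; ring
    · ring

/-- The four orientations are the coefficients of the affine dependence of the four points. The
signs allow it to be split into a convex combination of `p`, `q` that equals one of `r`, `s`. -/
theorem not_disjoint_segment_of_orient {p q r s : ℝ × ℝ} (hα : orient q r s ≤ 0)
    (hβ : 0 ≤ orient p r s) (hαβ : orient q r s < orient p r s) (hγ : 0 ≤ orient p q s)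
    (hδ : orient p q r ≤ 0) : ¬ Disjoint (segment ℝ p q) (segment ℝ r s) := by
  set α := orient q r s with hαd
  set β := orient p r s with hβd
  set γ := orient p q s with hγd
  set δ := orient p q r with hδd
  have e : β - α = γ - δ := by
    rw [hαd, hβd, hγd, hδd]; unfold orient; ring
  have e₁ : γ * r.1 - δ * s.1 = β * q.1 - α * p.1 := by
    rw [hαd, hβd, hγd, hδd]; unfold orient; ring
  have e₂ : γ * r.2 - δ * s.2 = β * q.2 - α * p.2 := by
    rw [hαd, hβd, hγd, hδd]; unfold orient; ring
  have hpos : 0 < γ - δ := by linarith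
  rw [Set.not_disjoint_iff]
  refine ⟨((γ * r.1 - δ * s.1) / (γ - δ), (γ * r.2 - δ * s.2) / (γ - δ)),
    mem_segment_of_comb (a := -α) (b := β) (by linarith) hβ (by linarith) ?_ ?_,
    mem_segment_of_comb (a := γ) (b := -δ) hγ (by linarith) (by linarith) ?_ ?_⟩
  · rw [e₁, show -α + β = γ - δ by linarith]; field_simp; ring
  · rw [e₂, show -α + β = γ - δ by linarith]; field_simp; ring
  · rw [show γ + -δ = γ - δ by ring]; field_simp; ring
  · rw [show γ + -δ = γ - δ by ring]; field_simp; ring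

theorem orient_swap (p q r : ℝ × ℝ) : orient q p r = - orient p q r := by unfold orient; ring

theorem orient_rotate (p q r : ℝ × ℝ) : orient q r p = orient p q r := by unfold orient; ring

/-- Interleaved disjoint segments: the one that starts below stays below. -/
theorem orient_neg_iff_of_interleaved {p q r s : ℝ × ℝ} (hpr : LexLT p r) (hrq : LexLT r q)
    (hqs : LexLT q s) (hd : Disjoint (segment ℝ p q) (segment ℝ r s)) :
    orient p q r < 0 ↔ ¬ orient r s q < 0 := by
  have hδ : orient p q r ≠ 0 := fun h =>
    Set.disjoint_left.1 hd (mem_segment_of_orient_eq_zero hpr hrq h) (left_mem_segment ℝ r s)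
  have hα : orient r s q ≠ 0 := fun h =>
    Set.disjoint_left.1 hd (right_mem_segment ℝ p q) (mem_segment_of_orient_eq_zero hrq hqs h)
  rw [orient_rotate q r s] at hα ⊢
  constructor
  · intro h₁ h₂
    -- The three orientations are the coefficients of a linear relation between `q - p`, `s - q` and
    -- `q - r`. These vectors are lexicographically positive, so two signs determine the third.
    have hγ : 0 < orient p q s := pos_of_lexLT_comb (neg_pos.2 h₂) (neg_pos.2 h₁)
      (hpr.trans hrq) hqs hrq (by unfold orient; ring) (by unfold orient; ring)
    have hβ : 0 < orient p r s := pos_of_lexLT_comb (neg_pos.2 h₂) (neg_pos.2 h₁)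
      hpr (hrq.trans hqs) hrq (by unfold orient; ring) (by unfold orient; ring)
    exact not_disjoint_segment_of_orient h₂.le hβ.le (by linarith) hγ.le h₁.le hd
  · intro h₂
    by_contra h₁
    replace h₂ : 0 < orient q r s := lt_of_le_of_ne (not_lt.1 h₂) hα.symm
    replace h₁ : 0 < orient p q r := lt_of_le_of_ne (not_lt.1 h₁) hδ.symm
    have hγ : 0 < - orient p q s := pos_of_lexLT_comb h₂ h₁
      (hpr.trans hrq) hqs hrq (by unfold orient; ring) (by unfold orient; ring)
    have hβ : 0 < - orient p r s := pos_of_lexLT_comb h₂ h₁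
      hpr (hrq.trans hqs) hrq (by unfold orient; ring) (by unfold orient; ring)
    rw [segment_symm] at hd
    exact not_disjoint_segment_of_orient (by linarith) h₂.le (by linarith)
      (by rw [orient_swap]; exact hγ.le) (by rw [orient_swap]; linarith) hd

/-- Nested disjoint segments: the ends of the inner one lie on the same side of the outer one. -/
theorem orient_neg_iff_of_nested {p q r s : ℝ × ℝ} (hpr : LexLT p r) (hrs : LexLT r s)
    (hsq : LexLT s q) (hd : Disjoint (segment ℝ p q) (segment ℝ r s)) :
    orient p q r < 0 ↔ orient p q s < 0 := by
  have hδ : orient p q r ≠ 0 := fun h => Set.disjoint_left.1 hd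
    (mem_segment_of_orient_eq_zero hpr (hrs.trans hsq) h) (left_mem_segment ℝ r s)
  have hγ : orient p q s ≠ 0 := fun h => Set.disjoint_left.1 hd
    (mem_segment_of_orient_eq_zero (hpr.trans hrs) hsq h) (right_mem_segment ℝ r s)
  have hpq := hpr.trans (hrs.trans hsq)
  constructor
  · intro h₁
    by_contra h₂
    replace h₂ : 0 < orient p q s := lt_of_le_of_ne (not_lt.1 h₂) hγ.symm
    have hβ : 0 < orient p r s := pos_of_lexLT_comb h₂ (neg_pos.2 h₁)
      hpr (hpr.trans hrs) hpq (by unfold orient; ring) (by unfold orient; ring)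
    have hα : 0 < - orient q r s := pos_of_lexLT_comb h₂ (neg_pos.2 h₁)
      (hrs.trans hsq) hsq hpq (by unfold orient; ring) (by unfold orient; ring)
    exact not_disjoint_segment_of_orient (by linarith) hβ.le (by linarith) h₂.le h₁.le hd
  · intro h₂
    by_contra h₁
    replace h₁ : 0 < orient p q r := lt_of_le_of_ne (not_lt.1 h₁) hδ.symm
    have hβ : 0 < - orient p r s := pos_of_lexLT_comb (neg_pos.2 h₂) h₁
      hpr (hpr.trans hrs) hpq (by unfold orient; ring) (by unfold orient; ring)
    have hα : 0 < orient q r s := pos_of_lexLT_comb (neg_pos.2 h₂) h₁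
      (hrs.trans hsq) hsq hpq (by unfold orient; ring) (by unfold orient; ring)
    rw [segment_symm] at hd
    exact not_disjoint_segment_of_orient (by linarith) hα.le (by linarith)
      (by rw [orient_swap]; linarith) (by rw [orient_swap]; linarith) hd

/-! ### Parity of ray crossings -/

open Classical in
/-- The indicator of the lexicographic order. -/
noncomputable def lexInd (p q : ℝ × ℝ) : ZMod 2 := if LexLT p q then 1 else 0

open Classical in
/-- The indicator of the event that the upward vertical ray from `r` meets the segment from `p`
to `q`, ties being broken lexicographically. -/
noncomputable def rayInd (p q r : ℝ × ℝ) : ZMod 2 :=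
  if LexLT p r ∧ LexLT r q ∧ orient p q r < 0 ∨ LexLT q r ∧ LexLT r p ∧ orient q p r < 0
  then 1 else 0

theorem lexInd_add_lexInd {p q : ℝ × ℝ} (h : p ≠ q) : lexInd p q + lexInd q p = 1 := by
  rcases lexLT_or_lexLT h with h | h <;> simp [lexInd, h, h.asymm]

theorem rayInd_swap (p q r : ℝ × ℝ) : rayInd q p r = rayInd p q r := by
  unfold rayInd
  congr 1
  exact propext or_comm

theorem rayInd_self (p r : ℝ × ℝ) : rayInd p p r = 0 := by
  unfold rayInd
  rw [if_neg]
  rintro (⟨h₁, h₂, -⟩ | ⟨h₁, h₂, -⟩) <;> exact h₁.asymm h₂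

open Classical in
theorem rayInd_of_lexLT {p q r : ℝ × ℝ} (h : LexLT p q) :
    rayInd p q r = if LexLT p r ∧ LexLT r q ∧ orient p q r < 0 then 1 else 0 := by
  unfold rayInd
  congr 1
  refine propext ⟨?_, .inl⟩
  rintro (h' | ⟨h₁, h₂, -⟩)
  · exact h'
  · exact absurd (h₁.trans h₂) h.asymm

/-- In lexicographic order the two segments are intervals. If they are separated, no end is below
the other segment; if interleaved, exactly one is; if nested, both inner ends are or neither is. -/
theorem rayInd_add_aux {p q r s : ℝ × ℝ} (hpq : LexLT p q) (hrs : LexLT r s) (hpr : LexLT p r)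
    (hd : Disjoint (segment ℝ p q) (segment ℝ r s)) :
    rayInd p q r + rayInd p q s + rayInd r s p + rayInd r s q =
      lexInd r p + lexInd s p + lexInd r q + lexInd s q := by
  have hqr : q ≠ r := fun h => Set.disjoint_left.1 hd (right_mem_segment ℝ p q)
    (h ▸ left_mem_segment ℝ r s)
  have hqs : q ≠ s := fun h => Set.disjoint_left.1 hd (right_mem_segment ℝ p q)
    (h ▸ right_mem_segment ℝ r s)
  have hps := hpr.trans hrs
  simp only [rayInd_of_lexLT hpq, rayInd_of_lexLT hrs]
  have e₁ : lexInd r p = 0 := if_neg hpr.asymm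
  have e₂ : lexInd s p = 0 := if_neg hps.asymm
  rw [e₁, e₂]
  rcases lexLT_or_lexLT hqr with h | h
  · have h' := h.trans hrs
    simp [lexInd, h.asymm, h'.asymm, hpr.asymm]
  rcases lexLT_or_lexLT hqs with h' | h'
  · have := orient_neg_iff_of_interleaved hpr h h' hd
    by_cases h₁ : orient p q r < 0
    · have h₂ := this.1 h₁
      simp [lexInd, h, h', h'.asymm, hpr, hpr.asymm, h₁, h₂]
    · have h₂ : orient r s q < 0 := by by_contra h₂; exact h₁ (this.2 h₂)
      simp [lexInd, h, h', h'.asymm, hpr, hpr.asymm, h₁, h₂]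
  · have := orient_neg_iff_of_nested hpr hrs h' hd
    simp only [lexInd, h, h', h'.asymm, hpr, hps, hpr.asymm, this]
    by_cases h₁ : orient p q s < 0 <;> simp [h₁]; grind

/-- The normalisation of the order is harmless: the left side is symmetric, and exchanging the two
segments on the right changes each of four terms by 1. -/
theorem rayInd_add {p q r s : ℝ × ℝ} (hd : Disjoint (segment ℝ p q) (segment ℝ r s)) :
    rayInd p q r + rayInd p q s + rayInd r s p + rayInd r s q =
      lexInd r p + lexInd s p + lexInd r q + lexInd s q := by
  have hne : ∀ x ∈ segment ℝ p q, ∀ y ∈ segment ℝ r s, x ≠ y := fun x hx y hy h =>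
    Set.disjoint_left.1 hd hx (h ▸ hy)
  have hp := left_mem_segment ℝ p q
  have hq := right_mem_segment ℝ p q
  have hr := left_mem_segment ℝ r s
  have hs := right_mem_segment ℝ r s
  rcases eq_or_ne p q with rfl | hpq
  · simp only [rayInd_self]; grind
  rcases eq_or_ne r s with rfl | hrs
  · simp only [rayInd_self]; grind
  have i₁ := lexInd_add_lexInd (hne _ hp _ hr)
  have i₂ := lexInd_add_lexInd (hne _ hp _ hs)
  have i₃ := lexInd_add_lexInd (hne _ hq _ hr)
  have i₄ := lexInd_add_lexInd (hne _ hq _ hs)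
  have key : ∀ p' q' r' s' : ℝ × ℝ, LexLT p' q' → LexLT r' s' → p' ≠ r' →
      Disjoint (segment ℝ p' q') (segment ℝ r' s') →
      (rayInd p' q' r' + rayInd p' q' s' + rayInd r' s' p' + rayInd r' s' q' =
        lexInd r' p' + lexInd s' p' + lexInd r' q' + lexInd s' q') ∨
      (rayInd p' q' r' + rayInd p' q' s' + rayInd r' s' p' + rayInd r' s' q' =
        lexInd p' r' + lexInd q' r' + lexInd p' s' + lexInd q' s') := by
    intro p' q' r' s' h₁ h₂ h₃ hd'
    rcases lexLT_or_lexLT h₃ with h | h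
    · exact .inl (rayInd_add_aux h₁ h₂ h hd')
    · have := rayInd_add_aux h₂ h₁ h hd'.symm
      right; linear_combination this
  rcases lexLT_or_lexLT hpq with h₁ | h₁ <;> rcases lexLT_or_lexLT hrs with h₂ | h₂
  · rcases key p q r s h₁ h₂ (hne _ hp _ hr) hd with h | h <;> grind
  · have := key p q s r h₁ h₂ (hne _ hp _ hs) (by rwa [segment_symm ℝ s r])
    simp only [rayInd_swap r s] at this
    rcases this with h | h <;> grind
  · have := key q p r s h₁ h₂ (hne _ hq _ hr) (by rwa [segment_symm ℝ q p])
    simp only [rayInd_swap p q] at this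
    rcases this with h | h <;> grind
  · have := key q p s r h₁ h₂ (hne _ hq _ hs) (by rwa [segment_symm ℝ q p, segment_symm ℝ s r])
    simp only [rayInd_swap p q, rayInd_swap r s] at this
    rcases this with h | h <;> grind

/-- The number modulo `2` of the segments of the polygonal line `p 0, …, p m` that the upward
vertical ray from `r` meets. -/
noncomputable def pathRayInd (p : ℕ → ℝ × ℝ) (m : ℕ) (r : ℝ × ℝ) : ZMod 2 :=
  ∑ i ∈ Finset.range m, rayInd (p i) (p (i + 1)) r

theorem sum_range_add_succ (f : ℕ → ZMod 2) (m : ℕ) :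
    ∑ i ∈ Finset.range m, (f i + f (i + 1)) = f 0 + f m := by
  induction m with
  | zero => simp; grind
  | succ k ih => rw [Finset.sum_range_succ, ih]; grind

/-- Summing the relation for segments over all pairs, every inner vertex of a path is counted twice,
so only the ends survive modulo 2. -/
theorem pathRayInd_add {p q : ℕ → ℝ × ℝ} {m n : ℕ}
    (hd : Disjoint (⋃ i ∈ Finset.range m, segment ℝ (p i) (p (i + 1)))
      (⋃ j ∈ Finset.range n, segment ℝ (q j) (q (j + 1)))) :
    pathRayInd p m (q 0) + pathRayInd p m (q n) + pathRayInd q n (p 0) + pathRayInd q n (p m) =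
      lexInd (q 0) (p 0) + lexInd (q n) (p 0) + lexInd (q 0) (p m) + lexInd (q n) (p m) := by
  have h : ∑ i ∈ Finset.range m, ∑ j ∈ Finset.range n,
      ((rayInd (p i) (p (i + 1)) (q j) + rayInd (p i) (p (i + 1)) (q (j + 1))) +
      (rayInd (q j) (q (j + 1)) (p i) + rayInd (q j) (q (j + 1)) (p (i + 1)))) =
      ∑ i ∈ Finset.range m, ∑ j ∈ Finset.range n,
      ((lexInd (q j) (p i) + lexInd (q j) (p (i + 1))) +
        (lexInd (q (j + 1)) (p i) + lexInd (q (j + 1)) (p (i + 1)))) := by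
    refine Finset.sum_congr rfl fun i hi => Finset.sum_congr rfl fun j hj => ?_
    have := rayInd_add (hd.mono
      (Set.subset_biUnion_of_mem (u := fun i => segment ℝ (p i) (p (i + 1))) hi)
      (Set.subset_biUnion_of_mem (u := fun j => segment ℝ (q j) (q (j + 1))) hj))
    linear_combination this
  have h₁ : ∀ i, ∑ j ∈ Finset.range n,
      (rayInd (p i) (p (i + 1)) (q j) + rayInd (p i) (p (i + 1)) (q (j + 1))) =
      rayInd (p i) (p (i + 1)) (q 0) + rayInd (p i) (p (i + 1)) (q n) := fun i =>
    sum_range_add_succ (fun j => rayInd (p i) (p (i + 1)) (q j)) n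
  have h₂ : ∀ j, ∑ i ∈ Finset.range m,
      (rayInd (q j) (q (j + 1)) (p i) + rayInd (q j) (q (j + 1)) (p (i + 1))) =
      rayInd (q j) (q (j + 1)) (p 0) + rayInd (q j) (q (j + 1)) (p m) := fun j =>
    sum_range_add_succ (fun i => rayInd (q j) (q (j + 1)) (p i)) m
  have h₃ : ∀ i, ∑ j ∈ Finset.range n,
      ((lexInd (q j) (p i) + lexInd (q j) (p (i + 1))) +
        (lexInd (q (j + 1)) (p i) + lexInd (q (j + 1)) (p (i + 1)))) =
      (lexInd (q 0) (p i) + lexInd (q n) (p i)) +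
        (lexInd (q 0) (p (i + 1)) + lexInd (q n) (p (i + 1))) := fun i => by
    rw [sum_range_add_succ (fun j => lexInd (q j) (p i) + lexInd (q j) (p (i + 1))) n]
    ring
  simp only [Finset.sum_add_distrib (s := Finset.range n)] at h
  rw [Finset.sum_add_distrib (s := Finset.range m)] at h
  simp only [← Finset.sum_add_distrib (s := Finset.range n), h₁, h₃] at h
  rw [Finset.sum_comm (s := Finset.range m)] at h
  simp only [h₂] at h
  rw [sum_range_add_succ (fun i => lexInd (q 0) (p i) + lexInd (q n) (p i)) m] at h
  simp only [Finset.sum_add_distrib] at h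
  unfold pathRayInd
  linear_combination h

/-! ### The parity form of planarity -/

/-- The parity form of planarity: a tournament on the vertices and indicators that say which vertices
are below which edges, such that two disjoint edges cross evenly. -/
def HasEvenCrossings {V : Type*} (G : SimpleGraph V) : Prop :=
  ∃ (lt : V → V → ZMod 2) (B : V → V → V → ZMod 2), (∀ u v, u ≠ v → lt u v + lt v u = 1) ∧
    ∀ u v w z, G.Adj u v → G.Adj w z → u ≠ w → u ≠ z → v ≠ w → v ≠ z →
      B u v w + B u v z + B w z u + B w z v = lt w u + lt z u + lt w v + lt z v

theorem IsPlanarGraph.hasEvenCrossings {V : Type*} {G : SimpleGraph V} (h : IsPlanarGraph G) :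
    HasEvenCrossings G := by
  obtain ⟨D⟩ := h
  have h₁ : ∀ u v : V, ∃ (m : ℕ) (p : ℕ → ℝ × ℝ), G.Adj u v → p 0 = D.point u ∧ p m = D.point v ∧
      D.curve s(u, v) = ⋃ i ∈ Finset.range m, segment ℝ (p i) (p (i + 1)) := by
    intro u v
    by_cases huv : G.Adj u v
    · obtain ⟨m, p, -, h₀, hm, -, -, -, hS⟩ := D.isPolygonalArc_curve u v huv
      exact ⟨m, p, fun _ => ⟨h₀, hm, hS⟩⟩
    -- A dummy path for non-adjacent pairs, so that `choose` gives total functions.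
    · exact ⟨0, fun _ => 0, fun h => absurd h huv⟩
  choose m p hp using h₁
  refine ⟨fun u v => lexInd (D.point u) (D.point v),
    fun u v w => pathRayInd (p u v) (m u v) (D.point w),
    fun u v huv => lexInd_add_lexInd (D.point_injective.ne huv), ?_⟩
  intro u v w z huv hwz h₁ h₂ h₃ h₄
  obtain ⟨e₁, e₂, e₃⟩ := hp u v huv
  obtain ⟨f₁, f₂, f₃⟩ := hp w z hwz
  have hd : Disjoint (D.curve s(u, v)) (D.curve s(w, z)) := by
    rw [Set.disjoint_iff]
    have hne : s(u, v) ≠ s(w, z) := by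
      rw [Ne, Sym2.eq_iff]; tauto
    refine (D.curve_inter_subset _ huv _ hwz hne).trans ?_
    rintro - ⟨x, ⟨hx₁, hx₂⟩, -⟩
    rw [Sym2.mem_iff] at hx₁ hx₂
    rcases hx₁ with rfl | rfl <;> tauto
  rw [e₃, f₃] at hd
  have := pathRayInd_add hd
  rw [e₁, e₂, f₁, f₂] at this
  exact this

theorem HasEvenCrossings.comap {V W : Type*} {G : SimpleGraph V} {H : SimpleGraph W}
    (h : HasEvenCrossings G) (f : W ↪ V) (hf : ∀ u v, H.Adj u v → G.Adj (f u) (f v)) :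
    HasEvenCrossings H := by
  obtain ⟨lt, B, h₁, h₂⟩ := h
  refine ⟨fun u v => lt (f u) (f v), fun u v w => B (f u) (f v) (f w),
    fun u v huv => h₁ _ _ (f.injective.ne huv), fun u v w z huv hwz e₁ e₂ e₃ e₄ => ?_⟩
  exact h₂ _ _ _ _ (hf _ _ huv) (hf _ _ hwz) (f.injective.ne e₁) (f.injective.ne e₂)
    (f.injective.ne e₃) (f.injective.ne e₄)

/-! ### Excluded subgraphs -/

section

variable {V : Type*} {G : SimpleGraph V}

/-- Nine arcs that join the points of one triple to those of another cannot satisfy the parity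
condition for every pair of arcs without common ends. -/
theorem even_crossings_K33_false {lt : V → V → ZMod 2} {a b : Fin 3 → V}
    {B : Fin 3 → Fin 3 → V → ZMod 2} (hlt : ∀ j l, j ≠ l → lt (b j) (b l) + lt (b l) (b j) = 1)
    (key : ∀ i j k l, i ≠ k → j ≠ l → B i j (a k) + B i j (b l) + B k l (a i) + B k l (b j) =
      lt (a k) (a i) + lt (b l) (a i) + lt (a k) (b j) + lt (b l) (b j)) : False := by
  -- Add the six equations for arcs at `a i` and `a k`. Indicators at points of `a` occur twice, and
  -- of the order terms only the three sums `lt (b j) (b l) + lt (b l) (b j) = 1` remain. So a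
  -- function of the row differs modulo 2 on any two of three rows, which is impossible.
  have s : ∀ i k, i ≠ k →
      ((B k 0 (b 1) + B k 0 (b 2)) + (B k 1 (b 0) + B k 1 (b 2)) + (B k 2 (b 0) + B k 2 (b 1))) +
      ((B i 0 (b 1) + B i 0 (b 2)) + (B i 1 (b 0) + B i 1 (b 2)) + (B i 2 (b 0) + B i 2 (b 1))) =
      1 := by
    intro i k hik
    have := key i 0 k 1 hik (by decide)
    have := key i 0 k 2 hik (by decide)
    have := key i 1 k 2 hik (by decide)
    have := key i 1 k 0 hik (by decide)
    have := key i 2 k 0 hik (by decide)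
    have := key i 2 k 1 hik (by decide)
    have := hlt 0 1 (by decide)
    have := hlt 0 2 (by decide)
    have := hlt 1 2 (by decide)
    grind
  have := s 0 1 (by decide)
  have := s 0 2 (by decide)
  have := s 1 2 (by decide)
  grind

theorem HasEvenCrossings.not_K33 (h : HasEvenCrossings G) {a b : Fin 3 → V}
    (ha : Function.Injective a) (hb : Function.Injective b) (hab : ∀ i j, G.Adj (a i) (b j)) :
    False := by
  obtain ⟨lt, B, h₁, h₂⟩ := h
  have hne : ∀ i j, a i ≠ b j := fun i j => (hab i j).ne
  exact even_crossings_K33_false (lt := lt) (a := a) (b := b) (B := fun i j => B (a i) (b j))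
    (fun j l hjl => h₁ _ _ (hb.ne hjl)) fun i j k l hik hjl => h₂ (a i) (b j) (a k) (b l)
      (hab i j) (hab k l) (ha.ne hik) (hne _ _) (hne _ _).symm (hb.ne hjl)

/-- A planar graph has no `K₃₃` with one edge subdivided by a vertex `x`. -/
theorem HasEvenCrossings.not_subdivided_K33 (h : HasEvenCrossings G) {a b : Fin 3 → V} {x : V}
    (ha : Function.Injective a) (hb : Function.Injective b) (hne : ∀ i j, a i ≠ b j)
    (hab : ∀ i j, (i, j) ≠ (0, 0) → G.Adj (a i) (b j)) (hax : ∀ i, a i ≠ x) (hbx : ∀ j, b j ≠ x)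
    (h₀ : G.Adj (a 0) x) (h₁ : G.Adj x (b 0)) : False := by
  obtain ⟨lt, B, hlt, hB⟩ := h
  have first : ∀ k l, k ≠ 0 → l ≠ 0 →
      (B (a 0) x (a k) + B x (b 0) (a k)) + (B (a 0) x (b l) + B x (b 0) (b l)) +
        B (a k) (b l) (a 0) + B (a k) (b l) (b 0) =
      lt (a k) (a 0) + lt (b l) (a 0) + lt (a k) (b 0) + lt (b l) (b 0) := by
    intro k l hk hl
    have hkl := hab k l (by simp [hk])
    -- Adding the equations of the two halves of the subdivided edge cancels every term at `x`.
    have e := hB (a 0) x (a k) (b l) h₀ hkl (ha.ne hk.symm) (hne _ _) (hax k).symm (hbx l).symm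
    have f := hB x (b 0) (a k) (b l) h₁ hkl (hax k).symm (hbx l).symm (hne _ _).symm (hb.ne hl.symm)
    grind
  -- The subdivided edge is one arc, whose indicator is the sum of those of its halves.
  refine even_crossings_K33_false (lt := lt) (a := a) (b := b)
    (B := fun i j r => if (i, j) = (0, 0) then B (a 0) x r + B x (b 0) r else B (a i) (b j) r)
    (fun j l hjl => hlt _ _ (hb.ne hjl)) fun i j k l hik hjl => ?_
  by_cases hij : (i, j) = (0, 0)
  · obtain ⟨rfl, rfl⟩ := Prod.mk.inj hij
    have hkl : (k, l) ≠ (0, 0) := by rintro h; exact hik (Prod.mk.inj h).1.symm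
    simp only [if_pos, hkl, if_false]
    exact first k l hik.symm hjl.symm
  by_cases hkl : (k, l) = (0, 0)
  · obtain ⟨rfl, rfl⟩ := Prod.mk.inj hkl
    simp only [if_pos, hij, if_false]
    -- The order terms appear reversed; four reversals change the sum by `4 = 0`.
    have := first i j hik hjl
    have := hlt _ _ (ha.ne hik)
    have := hlt _ _ (hb.ne hjl)
    have := hlt _ _ (hne i 0)
    have := hlt _ _ (hne 0 j)
    grind
  · simp only [hij, hkl, if_false]
    exact hB (a i) (b j) (a k) (b l) (hab i j hij) (hab k l hkl) (ha.ne hik) (hne _ _)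
      (hne _ _).symm (hb.ne hjl)

/-- For any four vertices the equations of the three perfect matchings add up to 1. Over all five
quadruples this gives `5 = 1`, but every indicator involves three vertices and so occurs in two
quadruples. -/
theorem HasEvenCrossings.not_K5 (h : HasEvenCrossings G) {a : Fin 5 → V}
    (ha : ∀ i j, i ≠ j → G.Adj (a i) (a j)) : False := by
  obtain ⟨lt, B, hlt, hB⟩ := h
  have key : ∀ i j k l, i ≠ j → k ≠ l → i ≠ k → i ≠ l → j ≠ k → j ≠ l → _ :=
    fun i j k l h₁ h₂ h₃ h₄ h₅ h₆ => hB (a i) (a j) (a k) (a l) (ha _ _ h₁) (ha _ _ h₂)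
      (ha _ _ h₃).ne (ha _ _ h₄).ne (ha _ _ h₅).ne (ha _ _ h₆).ne
  have quad : ∀ i j k l, i < j → j < k → k < l →
      (B (a i) (a j) (a k) + B (a i) (a j) (a l) + B (a k) (a l) (a i) + B (a k) (a l) (a j)) +
      (B (a i) (a k) (a j) + B (a i) (a k) (a l) + B (a j) (a l) (a i) + B (a j) (a l) (a k)) +
      (B (a i) (a l) (a j) + B (a i) (a l) (a k) + B (a j) (a k) (a i) + B (a j) (a k) (a l)) =
      1 := by
    intro i j k l h₁ h₂ h₃
    have h₄ := h₁.trans h₂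
    have h₅ := h₂.trans h₃
    have h₆ := h₄.trans h₃
    have := key i j k l h₁.ne h₃.ne h₄.ne h₆.ne h₂.ne h₅.ne
    have := key i k j l h₄.ne h₅.ne h₁.ne h₆.ne h₂.ne' h₃.ne
    have := key i l j k h₆.ne h₂.ne h₁.ne h₄.ne h₅.ne' h₃.ne'
    have := hlt _ _ (ha _ _ h₂.ne).ne
    have := hlt _ _ (ha _ _ h₃.ne).ne
    have := hlt _ _ (ha _ _ h₅.ne).ne
    clear key hB hlt ha h₁ h₂ h₃ h₄ h₅ h₆
    grind
  have := quad 0 1 2 3 (by decide) (by decide) (by decide)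
  have := quad 0 1 2 4 (by decide) (by decide) (by decide)
  have := quad 0 1 3 4 (by decide) (by decide) (by decide)
  have := quad 0 2 3 4 (by decide) (by decide) (by decide)
  have := quad 1 2 3 4 (by decide) (by decide) (by decide)
  grind

end

/-! ### Local structure of graphs without a double star -/

theorem doubleStar_isContained_iff {V : Type*} {G : SimpleGraph V} {k l : ℕ} :
    (doubleStar k l).IsContained G ↔ ∃ (u v : V) (a : Fin k → V) (b : Fin l → V), G.Adj u v ∧
      (∀ i, G.Adj u (a i)) ∧ (∀ j, G.Adj v (b j)) ∧ Function.Injective a ∧ Function.Injective b ∧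
      (∀ i, a i ≠ v) ∧ (∀ j, b j ≠ u) ∧ ∀ i j, a i ≠ b j := by
  constructor
  · rintro ⟨f⟩
    have hadj : ∀ {x y}, (doubleStar k l).Adj x y → G.Adj (f x) (f y) := fun h => f.toHom.map_adj h
    refine ⟨f (.inl none), f (.inr none), fun i => f (.inl (some i)), fun j => f (.inr (some j)),
      hadj (by simp [doubleStar]), fun i => hadj (by simp [doubleStar]),
      fun j => hadj (by simp [doubleStar]), fun i j h => ?_, fun i j h => ?_, fun i h => ?_,
      fun i h => ?_, fun i j h => ?_⟩
    · simpa using f.injective h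
    · simpa using f.injective h
    · simpa using f.injective h
    · simpa using f.injective h
    · simpa using f.injective h
  · rintro ⟨u, v, a, b, huv, ha, hb, ia, ib, hav, hbu, hab⟩
    let f : Option (Fin k) ⊕ Option (Fin l) → V :=
      Sum.elim (fun o => o.elim u a) (fun o => o.elim v b)
    have hf : Function.Injective f := by
      rintro ((_ | i) | (_ | i)) ((_ | j) | (_ | j)) h <;> simp only [f, Sum.elim_inl, Sum.elim_inr,
        Option.elim] at h
      · rfl
      · exact absurd h (ha j).ne
      · exact absurd h huv.ne
      · exact absurd h.symm (hbu j)
      · exact absurd h.symm (ha i).ne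
      · rw [ia h]
      · exact absurd h (hav i)
      · exact absurd h (hab i j)
      · exact absurd h.symm huv.ne
      · exact absurd h.symm (hav j)
      · rfl
      · exact absurd h (hb j).ne
      · exact absurd h (hbu i)
      · exact absurd h.symm (hab j i)
      · exact absurd h.symm (hb i).ne
      · rw [ib h]
    refine ⟨⟨⟨f, fun {x y} h => ?_⟩, hf⟩⟩
    rw [doubleStar, SimpleGraph.fromRel_adj] at h
    obtain ⟨-, (⟨rfl, rfl⟩ | ⟨rfl, i, rfl⟩ | ⟨rfl, i, rfl⟩) |
      (⟨rfl, rfl⟩ | ⟨rfl, i, rfl⟩ | ⟨rfl, i, rfl⟩)⟩ := h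
    exacts [huv, ha i, hb i, huv.symm, (ha i).symm, (hb i).symm]

section

variable {V : Type*} {G : SimpleGraph V}

theorem doubleStar_isContained_of_finset {u v : V} {k l : ℕ} (huv : G.Adj u v) {A B : Finset V}
    (hA : ∀ x ∈ A, G.Adj u x ∧ x ≠ v) (hB : ∀ x ∈ B, G.Adj v x ∧ x ≠ u) (hAB : Disjoint A B)
    (cA : k ≤ A.card) (cB : l ≤ B.card) : (doubleStar k l).IsContained G := by
  obtain ⟨A', hA', rfl⟩ := Finset.exists_subset_card_eq cA
  obtain ⟨B', hB', rfl⟩ := Finset.exists_subset_card_eq cB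
  refine doubleStar_isContained_iff.2 ⟨u, v, fun i => A'.equivFin.symm i,
    fun j => B'.equivFin.symm j, huv, fun i => (hA _ (hA' (A'.equivFin.symm i).2)).1,
    fun i => (hB _ (hB' (B'.equivFin.symm i).2)).1,
    Subtype.val_injective.comp A'.equivFin.symm.injective,
    Subtype.val_injective.comp B'.equivFin.symm.injective,
    fun i => (hA _ (hA' (A'.equivFin.symm i).2)).2,
    fun i => (hB _ (hB' (B'.equivFin.symm i).2)).2, fun i j h => ?_⟩
  have h' : (A'.equivFin.symm i : V) = B'.equivFin.symm j := h
  exact Finset.disjoint_left.1 hAB (hA' (A'.equivFin.symm i).2)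
    (h'.symm ▸ hB' (B'.equivFin.symm j).2)

theorem HasEvenCrossings.not_K33_finset (h : HasEvenCrossings G) {A B : Finset V} (hA : A.card = 3)
    (hB : B.card = 3) (hAB : ∀ x ∈ A, ∀ y ∈ B, G.Adj x y) : False :=
  h.not_K33 (a := fun i => (A.equivFinOfCardEq hA).symm i)
    (b := fun i => (B.equivFinOfCardEq hB).symm i)
    (Subtype.val_injective.comp (A.equivFinOfCardEq hA).symm.injective)
    (Subtype.val_injective.comp (B.equivFinOfCardEq hB).symm.injective)
    fun i j => hAB _ ((A.equivFinOfCardEq hA).symm i).2 _ ((B.equivFinOfCardEq hB).symm j).2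

theorem HasEvenCrossings.not_K5_finset (h : HasEvenCrossings G) {A : Finset V} (hA : 5 ≤ A.card)
    (hadj : ∀ x ∈ A, ∀ y ∈ A, x ≠ y → G.Adj x y) : False := by
  obtain ⟨A', hA', hc⟩ := Finset.exists_subset_card_eq hA
  refine h.not_K5 (a := fun i => (A'.equivFinOfCardEq hc).symm i) fun i j hij =>
    hadj _ (hA' ((A'.equivFinOfCardEq hc).symm i).2) _ (hA' ((A'.equivFinOfCardEq hc).symm j).2) ?_
  exact (Subtype.val_injective.comp (A'.equivFinOfCardEq hc).symm.injective).ne hij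

variable [Fintype V] [DecidableEq V] [DecidableRel G.Adj]

/-- Two such vertices could be the leaves at `u`, and `v` has four more neighbours to serve as its
leaves. -/
theorem card_neighborFinset_sdiff_le_one (hG : (doubleStar 2 4).Free G) {u v : V} (huv : G.Adj u v)
    (hv : 5 ≤ G.degree v) : (G.neighborFinset u \ insert v (G.neighborFinset v)).card ≤ 1 := by
  by_contra! h
  refine hG (doubleStar_isContained_of_finset huv
    (A := G.neighborFinset u \ insert v (G.neighborFinset v)) (B := (G.neighborFinset v).erase u)
    ?_ ?_ ?_ h ?_)
  · intro x hx
    simp only [Finset.mem_sdiff, SimpleGraph.mem_neighborFinset, Finset.mem_insert, not_or] at hx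
    exact ⟨hx.1, hx.2.1⟩
  · intro x hx
    simpa [and_comm] using hx
  · rw [Finset.disjoint_left]
    intro x hx hx'
    simp at hx hx'
    tauto
  · rw [Finset.card_erase_of_mem (by simpa using huv.symm), SimpleGraph.card_neighborFinset_eq_degree]
    omega

/-- Whichever two leaves are chosen at `u`, at least `7 - 1 - 2 = 4` neighbours of `v` are left. -/
theorem degree_le_two_of_adj (hG : (doubleStar 2 4).Free G) {u v : V} (huv : G.Adj u v)
    (hv : 7 ≤ G.degree v) : G.degree u ≤ 2 := by
  by_contra! h
  obtain ⟨A, hA, hc⟩ := Finset.exists_subset_card_eq (s := (G.neighborFinset u).erase v) (n := 2)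
    (by rw [Finset.card_erase_of_mem (by simpa using huv),
      SimpleGraph.card_neighborFinset_eq_degree]; omega)
  refine hG (doubleStar_isContained_of_finset huv (A := A)
    (B := (G.neighborFinset v).erase u \ A) ?_ ?_ Finset.disjoint_sdiff hc.ge ?_)
  · intro x hx
    simpa [and_comm] using hA hx
  · intro x hx
    rw [Finset.mem_sdiff] at hx
    simpa [and_comm] using hx.1
  · have := Finset.le_card_sdiff A ((G.neighborFinset v).erase u)
    rw [Finset.card_erase_of_mem (by simpa using huv.symm),
      SimpleGraph.card_neighborFinset_eq_degree] at this
    omega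

/-- With one leaf of `u` outside the closed neighbourhood of `v`, the other leaf costs `v` at most
one neighbour, and `6 - 1 - 1 = 4` are left. -/
theorem neighborFinset_subset_of_adj (hG : (doubleStar 2 4).Free G) {u v : V} (huv : G.Adj u v)
    (hv : 6 ≤ G.degree v) (hu : 3 ≤ G.degree u) :
    G.neighborFinset u ⊆ insert v (G.neighborFinset v) := by
  by_contra h
  obtain ⟨x, hx, hx'⟩ := Finset.not_subset.1 h
  simp only [SimpleGraph.mem_neighborFinset, Finset.mem_insert, not_or] at hx hx'
  have hc : 0 < (((G.neighborFinset u).erase v).erase x).card := by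
    rw [Finset.card_erase_of_mem (by simpa using ⟨hx'.1, hx⟩),
      Finset.card_erase_of_mem (by simpa using huv), SimpleGraph.card_neighborFinset_eq_degree]
    omega
  obtain ⟨y, hy⟩ := Finset.card_pos.1 hc
  simp only [Finset.mem_erase, SimpleGraph.mem_neighborFinset] at hy
  refine hG (doubleStar_isContained_of_finset huv (A := {x, y})
    (B := ((G.neighborFinset v).erase u).erase y) ?_ ?_ ?_ (Finset.card_pair hy.1.symm).ge ?_)
  · simp only [Finset.mem_insert, Finset.mem_singleton]
    rintro z (rfl | rfl)
    · exact ⟨hx, hx'.1⟩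
    · exact ⟨hy.2.2, hy.2.1⟩
  · intro z hz
    simp only [Finset.mem_erase, SimpleGraph.mem_neighborFinset] at hz
    exact ⟨hz.2.2, hz.2.1⟩
  · rw [Finset.disjoint_left]
    intro z hz hz'
    simp only [Finset.mem_insert, Finset.mem_singleton, Finset.mem_erase,
      SimpleGraph.mem_neighborFinset] at hz hz'
    rcases hz with rfl | rfl
    · exact hx'.2 hz'.2.2
    · exact hz'.1 rfl
  · have h₁ := Finset.pred_card_le_card_erase (s := (G.neighborFinset v).erase u) (a := y)
    rw [Finset.card_erase_of_mem (s := G.neighborFinset v) (by simpa using huv.symm),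
      SimpleGraph.card_neighborFinset_eq_degree] at h₁
    omega

end

/-! ### Clusters of vertices of degree five -/

namespace SimpleGraph

variable {V : Type*} [Fintype V] [DecidableEq V] (G : SimpleGraph V) [DecidableRel G.Adj]

/-- The neighbours of `v` that have degree five. -/
def fiveNeighbors (v : V) : Finset V := (G.neighborFinset v).filter fun w => G.degree w = 5

/-- The closed neighbourhood of `v` among the vertices of degree five. -/
def fiveCluster (v : V) : Finset V := insert v (G.fiveNeighbors v)

/-- The vertices of other degrees that are adjacent to a vertex in the cluster of `v`. -/
def clusterBoundary (v : V) : Finset V :=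
  ((G.fiveCluster v).biUnion fun u => G.neighborFinset u).filter fun w => G.degree w ≠ 5

/-- A graph with degrees three, four and five in which a vertex of degree five and a neighbour of
it have almost the same neighbours, and which satisfies the parity form of planarity. -/
structure IsReduced : Prop where
  three_le_degree : ∀ v, 3 ≤ G.degree v
  degree_le_five : ∀ v, G.degree v ≤ 5
  card_sdiff_le : ∀ {u v}, G.Adj u v → G.degree v = 5 →
    (G.neighborFinset u \ insert v (G.neighborFinset v)).card ≤ 1
  hasEvenCrossings : HasEvenCrossings G

variable {G}

omit [DecidableEq V] in
theorem mem_fiveNeighbors {v w : V} : w ∈ G.fiveNeighbors v ↔ G.Adj v w ∧ G.degree w = 5 := by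
  simp [fiveNeighbors]

theorem mem_fiveCluster {v w : V} :
    w ∈ G.fiveCluster v ↔ w = v ∨ G.Adj v w ∧ G.degree w = 5 := by
  simp [fiveCluster, mem_fiveNeighbors]

theorem mem_clusterBoundary {v w : V} :
    w ∈ G.clusterBoundary v ↔ (∃ u ∈ G.fiveCluster v, G.Adj u w) ∧ G.degree w ≠ 5 := by
  simp [clusterBoundary]

namespace IsReduced

/-- Two neighbours of `u` outside the closed neighbourhood of `v` are equal. -/
theorem eq_of_not_adj (h : G.IsReduced) {u v x y : V} (huv : G.Adj u v) (hv : G.degree v = 5)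
    (hx : G.Adj u x) (hxv : ¬ G.Adj v x) (hx' : x ≠ v) (hy : G.Adj u y) (hyv : ¬ G.Adj v y)
    (hy' : y ≠ v) : x = y := by
  refine Finset.card_le_one.1 (h.card_sdiff_le huv hv) x ?_ y ?_ <;> simp <;> tauto

/-- Otherwise `y` is the only neighbour of `u` outside the closed neighbourhood of `v`, and vice
versa. The other three neighbours of `u` are then adjacent to all of `u`, `v`, `y`, a `K₃₃`. -/
theorem adj_of_adj_of_adj (h : G.IsReduced) {u v y : V} (hu : G.degree u = 5) (hv : G.degree v = 5)
    (hy : G.degree y = 5) (huv : G.Adj u v) (huy : G.Adj u y) (hvy : v ≠ y) : G.Adj v y := by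
  by_contra hn
  have hn' : ¬ G.Adj y v := fun h => hn h.symm
  refine h.hasEvenCrossings.not_K33_finset (A := {u, v, y})
    (B := ((G.neighborFinset u).erase v).erase y)
    (Finset.card_eq_three.2 ⟨u, v, y, huv.ne, huy.ne, hvy, rfl⟩) ?_ ?_
  · rw [Finset.card_erase_of_mem (by simpa using ⟨hvy.symm, huy⟩),
      Finset.card_erase_of_mem (by simpa using huv), card_neighborFinset_eq_degree, hu]
  · intro a ha b hb
    simp only [Finset.mem_erase, mem_neighborFinset, ne_eq] at hb
    simp only [Finset.mem_insert, Finset.mem_singleton] at ha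
    rcases ha with rfl | rfl | rfl
    · exact hb.2.2
    · by_contra hab
      exact hb.1 (h.eq_of_not_adj huv hv hb.2.2 hab hb.2.1 huy hn hvy.symm)
    · by_contra hab
      exact hb.2.1 (h.eq_of_not_adj huy hy hb.2.2 hab hb.1 huv hn' hvy)

/-- A vertex of another degree that is adjacent to two clusters is adjacent to trivial clusters
only. -/
theorem fiveNeighbors_eq_empty (h : G.IsReduced) {w v v' : V} (hw : G.degree w ≠ 5)
    (hv : G.degree v = 5) (hv' : G.degree v' = 5) (hwv : G.Adj w v) (hwv' : G.Adj w v')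
    (hne : v ≠ v') (hn : ¬ G.Adj v v') : G.fiveNeighbors v = ∅ := by
  have hn' : ¬ G.Adj v' v := fun h => hn h.symm
  rw [Finset.eq_empty_iff_forall_notMem]
  intro u hu
  rw [mem_fiveNeighbors] at hu
  obtain ⟨hvu, hu⟩ := hu
  -- A third neighbour `c` of `w` is adjacent to both `v` and `v'`, because each of these already is
  -- the one exception for the other.
  obtain ⟨c, hc⟩ : (((G.neighborFinset w).erase v).erase v').Nonempty := by
    rw [← Finset.card_pos, Finset.card_erase_of_mem (by simpa using ⟨hne.symm, hwv'⟩),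
      Finset.card_erase_of_mem (by simpa using hwv), card_neighborFinset_eq_degree]
    have := h.three_le_degree w
    omega
  simp only [Finset.mem_erase, mem_neighborFinset] at hc
  obtain ⟨hcv', hcv, hwc⟩ := hc
  have hvc : G.Adj v c := by
    by_contra hvc
    exact hcv' (h.eq_of_not_adj hwv hv hwc hvc hcv hwv' hn hne.symm)
  have hvc' : G.Adj v' c := by
    by_contra hvc'
    exact hcv (h.eq_of_not_adj hwv' hv' hwc hvc' hcv' hwv hn' hne)
  have huv' : u ≠ v' := fun e => hn (e ▸ hvu)
  have hnuv' : ¬ G.Adj v' u := fun e => hn (h.adj_of_adj_of_adj hu hv hv' hvu.symm e.symm hne)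
  have huw : u ≠ w := fun e => hw (e ▸ hu)
  have huc : u ≠ c := fun e => hnuv' (e ▸ hvc')
  -- Otherwise `x` has two exceptions `u`, `v` with respect to `v'`. Hence `w` and `c` are two
  -- exceptions of `v` with respect to `u`.
  have key : ∀ x, G.Adj v' x → G.Adj v x → ¬ G.Adj u x := by
    intro x hx hx' hux
    exact hvu.ne (h.eq_of_not_adj hx.symm hv' hx'.symm hn' hne hux.symm hnuv' huv')
  exact hwc.ne (h.eq_of_not_adj hvu hu hwv.symm (key _ hwv'.symm hwv.symm) huw.symm
    hvc (key _ hvc' hvc) huc.symm)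

/-- Every neighbour of `w` of degree five other than `v` is outside the closed neighbourhood of `v`,
so there is at most one. -/
theorem card_fiveNeighbors_le_two (h : G.IsReduced) {v w : V} (hv : G.degree v = 5)
    (hwv : G.Adj w v) (he : G.fiveNeighbors v = ∅) :
    (G.fiveNeighbors w).card ≤ 2 := by
  have hn : ∀ x, G.degree x = 5 → ¬ G.Adj v x := fun x hx hvx => by
    have : x ∈ G.fiveNeighbors v := mem_fiveNeighbors.2 ⟨hvx, hx⟩
    simp [he] at this
  have h₁ : ((G.fiveNeighbors w).erase v).card ≤ 1 := by
    refine Finset.card_le_one.2 fun x hx y hy => ?_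
    simp only [Finset.mem_erase, mem_fiveNeighbors] at hx hy
    exact h.eq_of_not_adj hwv hv hx.2.1 (hn x hx.2.2) hx.1 hy.2.1 (hn y hy.2.2) hy.1
  have := Finset.pred_card_le_card_erase (s := G.fiveNeighbors w) (a := v)
  omega

theorem fiveCluster_adj (h : G.IsReduced) {v x y : V} (hv : G.degree v = 5)
    (hx : x ∈ G.fiveCluster v) (hy : y ∈ G.fiveCluster v) (hxy : x ≠ y) : G.Adj x y := by
  rw [mem_fiveCluster] at hx hy
  rcases hx with rfl | ⟨hx, hx'⟩ <;> rcases hy with rfl | ⟨hy, hy'⟩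
  · exact absurd rfl hxy
  · exact hy
  · exact hx.symm
  · exact h.adj_of_adj_of_adj hv hx' hy' hx hy hxy

theorem degree_of_mem_fiveCluster {v x : V} (hv : G.degree v = 5)
    (hx : x ∈ G.fiveCluster v) : G.degree x = 5 := by
  rw [mem_fiveCluster] at hx
  rcases hx with rfl | ⟨-, hx⟩
  · exact hv
  · exact hx

theorem mem_fiveCluster_of_adj (h : G.IsReduced) {v x y : V} (hv : G.degree v = 5)
    (hx : x ∈ G.fiveCluster v) (hy : G.degree y = 5) (hxy : G.Adj x y) : y ∈ G.fiveCluster v := by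
  rw [mem_fiveCluster] at hx ⊢
  rcases hx with rfl | ⟨hx, hx'⟩
  · exact .inr ⟨hxy, hy⟩
  · by_cases e : y = v
    · exact .inl e
    · exact .inr ⟨h.adj_of_adj_of_adj hx' hv hy hx.symm hxy (Ne.symm e), hy⟩

theorem fiveCluster_eq (h : G.IsReduced) {v x : V} (hv : G.degree v = 5)
    (hx : x ∈ G.fiveCluster v) : G.fiveCluster x = G.fiveCluster v := by
  have key : ∀ {v x : V}, G.degree v = 5 → x ∈ G.fiveCluster v →
      G.fiveCluster x ⊆ G.fiveCluster v := by
    intro v x hv hx y hy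
    rw [mem_fiveCluster] at hy
    rcases hy with rfl | ⟨hy, hy'⟩
    · exact hx
    · exact h.mem_fiveCluster_of_adj hv hx hy' hy
  refine (key hv hx).antisymm (key (degree_of_mem_fiveCluster hv hx) ?_)
  rw [mem_fiveCluster] at hx ⊢
  rcases hx with rfl | ⟨hx, -⟩
  · exact .inl rfl
  · exact .inr ⟨hx.symm, hv⟩

theorem card_sdiff_fiveCluster (h : G.IsReduced) {v x : V} (hv : G.degree v = 5)
    (hx : x ∈ G.fiveCluster v) :
    (G.neighborFinset x \ G.fiveCluster v).card + (G.fiveCluster v).card = 6 := by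
  have h₁ : (G.fiveCluster v).erase x ⊆ G.neighborFinset x := by
    intro y hy
    rw [Finset.mem_erase] at hy
    simpa using h.fiveCluster_adj hv hx hy.2 hy.1.symm
  have h₂ : G.neighborFinset x \ G.fiveCluster v =
      G.neighborFinset x \ (G.fiveCluster v).erase x := by
    ext y
    simp only [Finset.mem_sdiff, mem_neighborFinset, Finset.mem_erase, not_and]
    exact ⟨fun ⟨a, b⟩ => ⟨a, fun _ => b⟩, fun ⟨a, b⟩ => ⟨a, b a.ne'⟩⟩
  have h₃ := Finset.card_sdiff_add_card_eq_card h₁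
  rw [Finset.card_erase_of_mem hx, card_neighborFinset_eq_degree,
    degree_of_mem_fiveCluster hv hx] at h₃
  have h₄ : 0 < (G.fiveCluster v).card := Finset.card_pos.2 ⟨x, hx⟩
  rw [h₂]
  omega

theorem sdiff_subset_clusterBoundary (h : G.IsReduced) {v x : V} (hv : G.degree v = 5)
    (hx : x ∈ G.fiveCluster v) : G.neighborFinset x \ G.fiveCluster v ⊆ G.clusterBoundary v := by
  intro y hy
  rw [Finset.mem_sdiff, mem_neighborFinset] at hy
  exact mem_clusterBoundary.2 ⟨⟨x, hx, hy.1⟩, fun e => hy.2 (h.mem_fiveCluster_of_adj hv hx e hy.1)⟩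

theorem card_fiveCluster_le (h : G.IsReduced) {v : V} (hv : G.degree v = 5) :
    (G.fiveCluster v).card ≤ 4 := by
  by_contra! hc
  exact h.hasEvenCrossings.not_K5_finset hc fun x hx y hy => h.fiveCluster_adj hv hx hy

/-! ### Discharging -/

/-- The charge of a vertex. -/
def charge (G : SimpleGraph V) [DecidableRel G.Adj] (v : V) : ℚ := 31 - 7 * G.degree v

theorem three_le_charge (h : G.IsReduced) {w : V} (hw : G.degree w ≠ 5) : 3 ≤ charge G w := by
  have : G.degree w ≤ 4 := by have := h.degree_le_five w; omega
  have : (G.degree w : ℚ) ≤ 4 := by exact_mod_cast this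
  unfold charge
  linarith

theorem three_mul_card_le (h : G.IsReduced) (v : V) {s : Finset V} (hs : s ⊆ G.clusterBoundary v) :
    3 * (s.card : ℚ) ≤ ∑ w ∈ G.clusterBoundary v, charge G w := by
  have h₁ : ∀ w ∈ G.clusterBoundary v, 3 ≤ charge G w := fun w hw =>
    h.three_le_charge (mem_clusterBoundary.1 hw).2
  calc 3 * (s.card : ℚ) = ∑ w ∈ s, 3 := by simp [mul_comm]
    _ ≤ ∑ w ∈ s, charge G w := Finset.sum_le_sum fun w hw => h₁ w (hs hw)
    _ ≤ _ := Finset.sum_le_sum_of_subset_of_nonneg hs fun w hw _ => by linarith [h₁ w hw]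

/-- A vertex that is adjacent to exactly two vertices of a cluster of four, next to a vertex
`x` that is adjacent to the other two and to one of these. -/
theorem degree_eq_three (h : G.IsReduced) {a b c d x z : V} (hc : G.degree c = 5)
    (hK : ({a, b, c, d, x, z} : Finset V).card = 6) (hac : G.Adj a c) (hbc : G.Adj b c)
    (hcd : G.Adj c d) (had : G.Adj a d) (hbd : G.Adj b d) (hax : G.Adj a x) (hbx : G.Adj b x)
    (hcx : G.Adj c x) (hcz : G.Adj c z) (hdz : G.Adj d z) (haz : ¬ G.Adj a z) (hbz : ¬ G.Adj b z) :
    G.degree z = 3 := by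
  by_contra hz
  have hz4 : 4 ≤ G.degree z := by have := h.three_le_degree z; omega
  have hnc : insert c (G.neighborFinset c) = {a, b, c, d, x, z} := by
    refine (Finset.eq_of_subset_of_card_le ?_ ?_).symm
    · intro y hy
      simp only [Finset.mem_insert, Finset.mem_singleton] at hy
      simp only [Finset.mem_insert, mem_neighborFinset]
      rcases hy with rfl | rfl | rfl | rfl | rfl | rfl
      · exact .inr hac.symm
      · exact .inr hbc.symm
      · exact .inl rfl
      · exact .inr hcd
      · exact .inr hcx
      · exact .inr hcz
    · refine (Finset.card_insert_le _ _).trans ?_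
      rw [card_neighborFinset_eq_degree, hK, hc]
  -- Otherwise `z` has only `c`, `d` as neighbours in the closed neighbourhood of `c`, hence two
  -- outside it.
  have hxz : G.Adj x z := by
    by_contra hxz
    have h₁ := h.card_sdiff_le hcz.symm hc
    rw [hnc] at h₁
    have h₂ : G.neighborFinset z ⊆
        (G.neighborFinset z \ {a, b, c, d, x, z}) ∪ {c, d} := by
      intro y hy
      simp only [Finset.mem_union, Finset.mem_sdiff, hy, true_and]
      by_contra! hn
      have hy' := hn.1
      simp only [mem_neighborFinset] at hy
      simp only [Finset.mem_insert, Finset.mem_singleton] at hy' hn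
      rcases hy' with rfl | rfl | rfl | rfl | rfl | rfl
      · exact haz hy.symm
      · exact hbz hy.symm
      · exact hn.2 (.inl rfl)
      · exact hn.2 (.inr rfl)
      · exact hxz hy.symm
      · exact hy.ne rfl
    have h₃ := (Finset.card_le_card h₂).trans (Finset.card_union_le _ _)
    rw [card_neighborFinset_eq_degree] at h₃
    have := Finset.card_le_two (a := c) (b := d)
    omega
  have hab : a ≠ b := by
    rintro rfl
    rw [Finset.insert_eq_of_mem (by simp)] at hK
    have := Finset.card_le_five (a := a) (b := c) (c := d) (d := x) (e := z)
    omega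
  have hdx : d ≠ x := by
    rintro rfl
    rw [Finset.insert_eq_of_mem (a := d) (by simp)] at hK
    have := Finset.card_le_five (a := a) (b := b) (c := c) (d := d) (e := z)
    omega
  refine h.hasEvenCrossings.not_K33_finset (A := {a, b, z}) (B := {c, d, x})
    (Finset.card_eq_three.2 ⟨a, b, z, hab, ?_, ?_, rfl⟩)
    (Finset.card_eq_three.2 ⟨c, d, x, hcd.ne, hcx.ne, hdx, rfl⟩) ?_
  · rintro rfl
    rw [Finset.insert_eq_of_mem (by simp)] at hK
    have := Finset.card_le_five (a := b) (b := c) (c := d) (d := x) (e := a)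
    omega
  · rintro rfl
    rw [Finset.insert_eq_of_mem (a := b) (by simp)] at hK
    have := Finset.card_le_five (a := a) (b := c) (c := d) (d := x) (e := b)
    omega
  · intro p hp q hq
    simp only [Finset.mem_insert, Finset.mem_singleton] at hp hq
    rcases hp with rfl | rfl | rfl <;> rcases hq with rfl | rfl | rfl
    exacts [hac, had, hax, hbc, hbd, hbx, hcz.symm, hdz.symm, hxz.symm]

end IsReduced

end SimpleGraph

namespace SimpleGraph

variable {V : Type*} [Fintype V] [DecidableEq V] {G : SimpleGraph V} [DecidableRel G.Adj]

namespace IsReduced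

/-- Both vertices have two outer neighbours; if these were disjoint pairs, `p` would have two
neighbours outside the closed neighbourhood of `q`. -/
theorem inter_nonempty_of_card_eq_four (h : G.IsReduced) {v p q : V} (hv : G.degree v = 5)
    (hK : (G.fiveCluster v).card = 4) (hp : p ∈ G.fiveCluster v) (hq : q ∈ G.fiveCluster v)
    (hpq : p ≠ q) : ((G.neighborFinset p \ G.fiveCluster v) ∩
      (G.neighborFinset q \ G.fiveCluster v)).Nonempty := by
  by_contra hn
  rw [Finset.not_nonempty_iff_eq_empty] at hn
  have hadj := h.fiveCluster_adj hv hp hq hpq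
  have h₁ := h.card_sdiff_le hadj (degree_of_mem_fiveCluster hv hq)
  have h₂ := h.card_sdiff_fiveCluster hv hp
  have h₃ : G.neighborFinset p \ G.fiveCluster v ⊆
      G.neighborFinset p \ insert q (G.neighborFinset q) := by
    intro y hy
    have hy' : y ∉ G.neighborFinset q \ G.fiveCluster v := fun e =>
      Finset.notMem_empty y (hn ▸ Finset.mem_inter.2 ⟨hy, e⟩)
    simp only [Finset.mem_sdiff, Finset.mem_insert] at hy hy' ⊢
    refine ⟨hy.1, ?_⟩
    rintro (rfl | e)
    · exact hy.2 hq
    · exact hy' ⟨e, hy.2⟩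
  have := Finset.card_le_card h₃
  omega

/-- The boundary of a cluster of four vertices. -/
theorem sixteen_le_sum_charge (h : G.IsReduced) {v : V} (hv : G.degree v = 5)
    (hK : (G.fiveCluster v).card = 4) : 16 ≤ ∑ w ∈ G.clusterBoundary v, charge G w := by
  set K := G.fiveCluster v with hKd
  set O : V → Finset V := fun p => G.neighborFinset p \ K with hO
  have hO2 : ∀ p ∈ K, (O p).card = 2 := fun p hp => by
    have := h.card_sdiff_fiveCluster hv hp
    rw [← hKd] at this
    simp only [hO]; omega
  have hOi : ∀ p ∈ K, ∀ q ∈ K, p ≠ q → (O p ∩ O q).Nonempty := fun p hp q hq hpq =>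
    h.inter_nonempty_of_card_eq_four hv hK hp hq hpq
  have hOK : ∀ p y, y ∈ O p → y ∉ K := fun p y hy => (Finset.mem_sdiff.1 hy).2
  have hOa : ∀ p y, y ∈ O p → G.Adj p y := fun p y hy => by
    simpa using (Finset.mem_sdiff.1 hy).1
  have hOn : ∀ p y, y ∉ K → y ∉ O p → ¬ G.Adj p y := fun p y hy hy' e =>
    hy' (Finset.mem_sdiff.2 ⟨by simpa using e, hy⟩)
  have hOB : ∀ p ∈ K, O p ⊆ G.clusterBoundary v := fun p hp =>
    h.sdiff_subset_clusterBoundary hv hp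
  clear_value O
  -- A common outer neighbour would extend the cluster to a `K₅`.
  have hcommon : ∀ y, y ∉ K → ∃ p ∈ K, y ∉ O p := by
    intro y hy
    by_contra! hn
    refine h.hasEvenCrossings.not_K5_finset (A := insert y K)
      (by rw [Finset.card_insert_of_notMem hy, hK]) fun p hp q hq hpq => ?_
    rw [Finset.mem_insert] at hp hq
    rcases hp with rfl | hp <;> rcases hq with rfl | hq
    · exact absurd rfl hpq
    · exact (hOa _ _ (hn _ hq)).symm
    · exact hOa _ _ (hn _ hp)
    · exact h.fiveCluster_adj hv hp hq hpq
  -- two vertices of the cluster with the same outer neighbours, and the other two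
  have final : ∀ a b c d x y z, a ∈ K → b ∈ K → c ∈ K → d ∈ K → a ≠ b → a ≠ c → a ≠ d → b ≠ c →
      b ≠ d → c ≠ d → x ≠ y → x ≠ z → y ≠ z → O a = {x, y} → O b = {x, y} → O c = {x, z} →
      O d = {y, z} → 16 ≤ ∑ w ∈ G.clusterBoundary v, charge G w := by
    intro a b c d x y z ha hb hc hd hab hac had hbc hbd hcd hxy hxz hyz oa ob oc od
    have hx : x ∈ O a := by simp [oa]
    have hy : y ∈ O a := by simp [oa]
    have hz : z ∈ O c := by simp [oc]
    have hzK := hOK _ _ hz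
    have hxK := hOK _ _ hx
    have hne : ∀ {p q}, p ∈ K → q ∉ K → p ≠ q := fun hp hq e => hq (e ▸ hp)
    have hdeg : G.degree z = 3 := by
      refine h.degree_eq_three (a := a) (b := b) (c := c) (d := d) (x := x)
        (degree_of_mem_fiveCluster hv hc) ?_ (h.fiveCluster_adj hv ha hc hac)
        (h.fiveCluster_adj hv hb hc hbc) (h.fiveCluster_adj hv hc hd hcd)
        (h.fiveCluster_adj hv ha hd had) (h.fiveCluster_adj hv hb hd hbd) (hOa _ _ hx)
        (hOa _ _ (by simp [ob])) (hOa _ _ (by simp [oc])) (hOa _ _ hz) (hOa _ _ (by simp [od]))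
        (hOn _ _ hzK (by simp [oa, hxz.symm, hyz.symm]))
        (hOn _ _ hzK (by simp [ob, hxz.symm, hyz.symm]))
      have n₁ := hne ha hxK
      have n₂ := hne hb hxK
      have n₃ := hne hc hxK
      have n₄ := hne hd hxK
      have n₅ := hne ha hzK
      have n₆ := hne hb hzK
      have n₇ := hne hc hzK
      have n₈ := hne hd hzK
      simp [hab, hac, had, hbc, hbd, hcd, hxz, n₁, n₂, n₃, n₄, n₅, n₆, n₇, n₈]
    have hsub : ({x, y, z} : Finset V) ⊆ G.clusterBoundary v := by
      intro w hw
      simp only [Finset.mem_insert, Finset.mem_singleton] at hw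
      rcases hw with rfl | rfl | rfl
      · exact hOB a ha hx
      · exact hOB a ha hy
      · exact hOB c hc hz
    have hge : ∀ w ∈ G.clusterBoundary v, 3 ≤ charge G w := fun w hw =>
      h.three_le_charge (mem_clusterBoundary.1 hw).2
    have hz10 : charge G z = 10 := by simp only [charge, hdeg]; norm_num
    calc (16 : ℚ) ≤ charge G x + (charge G y + charge G z) := by
          have := hge x (hsub (by simp))
          have := hge y (hsub (by simp))
          linarith
      _ = ∑ w ∈ {x, y, z}, charge G w := by
          rw [Finset.sum_insert (by simp [hxy, hxz]), Finset.sum_pair hyz]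
      _ ≤ _ := Finset.sum_le_sum_of_subset_of_nonneg hsub fun w hw _ => by linarith [hge w hw]
  -- Pairwise intersecting pairs without a common element are the sides of a triangle `x`, `y`, `z`.
  -- Four vertices share three sides, so one side occurs twice; the vertex opposite to it has degree
  -- 3, and the charges are at least `3 + 3 + 10`.
  have ha : v ∈ K := by simp [hKd, fiveCluster]
  obtain ⟨x, y, hxy, oa⟩ := Finset.card_eq_two.1 (hO2 v ha)
  have hxK := hOK v x (by simp [oa])
  have hyK := hOK v y (by simp [oa])
  obtain ⟨d, hd, hdx⟩ := hcommon x hxK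
  obtain ⟨c, hc, hcy⟩ := hcommon y hyK
  have hvd : v ≠ d := by rintro rfl; simp [oa] at hdx
  have hvc : v ≠ c := by rintro rfl; simp [oa] at hcy
  have hdy : y ∈ O d := by
    obtain ⟨w, hw⟩ := hOi v ha d hd hvd
    rw [oa] at hw
    simp only [Finset.mem_inter, Finset.mem_insert, Finset.mem_singleton] at hw
    rcases hw with ⟨rfl | rfl, hw⟩
    · exact absurd hw hdx
    · exact hw
  have hcx : x ∈ O c := by
    obtain ⟨w, hw⟩ := hOi v ha c hc hvc
    rw [oa] at hw
    simp only [Finset.mem_inter, Finset.mem_insert, Finset.mem_singleton] at hw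
    rcases hw with ⟨rfl | rfl, hw⟩
    · exact hw
    · exact absurd hw hcy
  have hcd : c ≠ d := by rintro rfl; exact hcy hdy
  obtain ⟨z, hz⟩ := hOi c hc d hd hcd
  rw [Finset.mem_inter] at hz
  have hxz : x ≠ z := by rintro rfl; exact hdx hz.2
  have hyz : y ≠ z := by rintro rfl; exact hcy hz.1
  have pair : ∀ p ∈ K, ∀ s t, s ≠ t → s ∈ O p → t ∈ O p → O p = {s, t} := by
    intro p hp s t hst hs ht
    refine (Finset.eq_of_subset_of_card_le ?_ ?_).symm
    · intro w hw
      simp only [Finset.mem_insert, Finset.mem_singleton] at hw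
      rcases hw with rfl | rfl <;> assumption
    · rw [hO2 p hp, Finset.card_pair hst]
  have oc := pair c hc x z hxz hcx hz.1
  have od := pair d hd y z hyz hdy hz.2
  obtain ⟨b, hb⟩ : (((K.erase v).erase c).erase d).Nonempty := by
    rw [← Finset.card_pos, Finset.card_erase_of_mem (by simp [hd, hcd.symm, hvd.symm]),
      Finset.card_erase_of_mem (by simp [hc, hvc.symm]), Finset.card_erase_of_mem ha, hK]
    norm_num
  simp only [Finset.mem_erase] at hb
  obtain ⟨hbd, hbc, hbv, hb⟩ := hb
  have meet : ∀ p ∈ K, b ≠ p → ∀ s t, O p = {s, t} → s ∈ O b ∨ t ∈ O b := by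
    intro p hp hbp s t hst
    obtain ⟨w, hw⟩ := hOi b hb p hp hbp
    rw [hst] at hw
    simp only [Finset.mem_inter, Finset.mem_insert, Finset.mem_singleton] at hw
    rcases hw with ⟨hw, rfl | rfl⟩
    · exact .inl hw
    · exact .inr hw
  have key : (x ∈ O b ∧ y ∈ O b) ∨ (x ∈ O b ∧ z ∈ O b) ∨ (y ∈ O b ∧ z ∈ O b) := by
    have m₁ := meet v ha hbv x y oa
    have m₂ := meet c hc hbc x z oc
    have m₃ := meet d hd hbd y z od
    clear * - m₁ m₂ m₃
    tauto
  have sw : ∀ s t : V, ({s, t} : Finset V) = {t, s} := fun s t => Finset.pair_comm s t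
  rcases key with ⟨h₁, h₂⟩ | ⟨h₁, h₂⟩ | ⟨h₁, h₂⟩
  · exact final v b c d x y z ha hb hc hd hbv.symm hvc hvd hbc hbd hcd hxy hxz hyz oa
      (pair b hb x y hxy h₁ h₂) oc od
  · exact final c b v d x z y hc hb ha hd hbc.symm hvc.symm hcd hbv hbd hvd hxz hxy hyz.symm oc
      (pair b hb x z hxz h₁ h₂) oa (od.trans (sw _ _))
  · exact final d b v c y z x hd hb ha hc hbd.symm hvd.symm hcd.symm hbv hbc hvc hyz hxy.symm
      hxz.symm od (pair b hb y z hyz h₁ h₂) (oa.trans (sw _ _)) (oc.trans (sw _ _))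

/-- A cluster of two has at least four boundary vertices, the outer neighbours of `v`. So has a
cluster of three, since three boundary vertices would give a `K₃₃`. Each carries charge at least 3.
-/
theorem four_mul_card_le_sum_charge (h : G.IsReduced) {v : V} (hv : G.degree v = 5)
    (hne : G.fiveNeighbors v ≠ ∅) :
    4 * ((G.fiveCluster v).card : ℚ) ≤ ∑ w ∈ G.clusterBoundary v, charge G w := by
  have ha : v ∈ G.fiveCluster v := by simp [fiveCluster]
  have h₁ : 2 ≤ (G.fiveCluster v).card := by
    have : v ∉ G.fiveNeighbors v := by simp [mem_fiveNeighbors]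
    rw [fiveCluster, Finset.card_insert_of_notMem this]
    have := Finset.card_pos.2 (Finset.nonempty_iff_ne_empty.2 hne)
    omega
  have h₂ := h.card_fiveCluster_le hv
  have h₃ := h.card_sdiff_fiveCluster hv ha
  have h₄ := h.sdiff_subset_clusterBoundary hv ha
  obtain hc | hc | hc : (G.fiveCluster v).card = 2 ∨ (G.fiveCluster v).card = 3 ∨
      (G.fiveCluster v).card = 4 := by omega
  · have := h.three_mul_card_le v h₄
    have h₅ : (G.neighborFinset v \ G.fiveCluster v).card = 4 := by omega
    rw [h₅] at this
    rw [hc]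
    push_cast at this ⊢
    linarith
  · have h₅ : 4 ≤ (G.clusterBoundary v).card := by
      by_contra! hlt
      have heq : ∀ x ∈ G.fiveCluster v,
          G.neighborFinset x \ G.fiveCluster v = G.clusterBoundary v := fun x hx =>
        Finset.eq_of_subset_of_card_le (h.sdiff_subset_clusterBoundary hv hx)
          (by have := h.card_sdiff_fiveCluster hv hx; omega)
      refine h.hasEvenCrossings.not_K33_finset hc (B := G.clusterBoundary v) ?_ ?_
      · rw [← heq v ha]; omega
      · intro x hx y hy
        rw [← heq x hx] at hy
        simpa using (Finset.mem_sdiff.1 hy).1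
    have := h.three_mul_card_le v (Finset.Subset.refl _)
    have : (4 : ℚ) ≤ (G.clusterBoundary v).card := by exact_mod_cast h₅
    rw [hc]
    push_cast
    linarith
  · have := h.sixteen_le_sum_charge hv hc
    rw [hc]
    push_cast
    linarith

/-- The charge that a vertex of degree five receives if the other vertices share their charge
evenly among their neighbours of degree five. -/
def received (G : SimpleGraph V) [DecidableRel G.Adj] (v : V) : ℚ :=
  ∑ w ∈ (G.neighborFinset v).filter (fun w => G.degree w ≠ 5),
    charge G w / (G.fiveNeighbors w).card

theorem four_mul_card_le_sum_received (h : G.IsReduced) {v : V} (hv : G.degree v = 5) :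
    4 * ((G.fiveCluster v).card : ℚ) ≤ ∑ u ∈ G.fiveCluster v, received G u := by
  by_cases hne : G.fiveNeighbors v = ∅
  · have hw5 : ∀ w, G.Adj v w → G.degree w ≠ 5 := fun w hw e => by
      have : w ∈ G.fiveNeighbors v := mem_fiveNeighbors.2 ⟨hw, e⟩
      simp [hne] at this
    have hfil : (G.neighborFinset v).filter (fun w => G.degree w ≠ 5) = G.neighborFinset v :=
      Finset.filter_true_of_mem fun w hw => hw5 w (by simpa using hw)
    have hle : ∀ w ∈ G.neighborFinset v, (3 / 2 : ℚ) ≤ charge G w / (G.fiveNeighbors w).card := by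
      intro w hw
      rw [mem_neighborFinset] at hw
      have h₁ := h.three_le_charge (hw5 w hw)
      have h₂ := h.card_fiveNeighbors_le_two hv hw.symm hne
      have h₃ : 0 < (G.fiveNeighbors w).card :=
        Finset.card_pos.2 ⟨v, mem_fiveNeighbors.2 ⟨hw.symm, hv⟩⟩
      have h₂' : ((G.fiveNeighbors w).card : ℚ) ≤ 2 := by exact_mod_cast h₂
      have h₃' : (0 : ℚ) < (G.fiveNeighbors w).card := by exact_mod_cast h₃
      rw [le_div_iff₀ h₃']
      linarith
    have hsum := Finset.card_nsmul_le_sum _ _ _ hle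
    rw [card_neighborFinset_eq_degree, hv] at hsum
    simp only [fiveCluster, hne, insert_empty_eq, Finset.card_singleton, Finset.sum_singleton,
      received, hfil]
    norm_num at hsum ⊢
    linarith
  · refine (h.four_mul_card_le_sum_charge hv hne).trans (le_of_eq ?_)
    have hswap : ∑ u ∈ G.fiveCluster v, received G u =
        ∑ w ∈ G.clusterBoundary v, ∑ u ∈ G.fiveNeighbors w,
          charge G w / (G.fiveNeighbors w).card := by
      unfold received
      refine Finset.sum_comm' fun u w => ?_
      simp only [Finset.mem_filter, mem_neighborFinset, mem_clusterBoundary, mem_fiveNeighbors]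
      constructor
      · rintro ⟨hu, huw, hw⟩
        exact ⟨⟨huw.symm, degree_of_mem_fiveCluster hv hu⟩, ⟨u, hu, huw⟩, hw⟩
      · rintro ⟨⟨hwu, hu⟩, ⟨x, hx, hxw⟩, hw⟩
        refine ⟨?_, hwu.symm, hw⟩
        have hx5 := degree_of_mem_fiveCluster hv hx
        by_cases hxu : x = u
        · exact hxu ▸ hx
        refine h.mem_fiveCluster_of_adj hv hx hu ?_
        by_contra hn
        -- A boundary vertex that touches a second cluster would make the cluster of `v` trivial.
        have he := h.fiveNeighbors_eq_empty hw hx5 hu hxw.symm hwu hxu hn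
        have hcx : G.fiveCluster v = {x} := by
          rw [← h.fiveCluster_eq hv hx, fiveCluster, he]; rfl
        have hvx : v = x := by
          have : v ∈ G.fiveCluster v := by simp [fiveCluster]
          simpa [hcx] using this
        exact hne (hvx ▸ he)
    rw [hswap]
    refine Finset.sum_congr rfl fun w hw => ?_
    obtain ⟨⟨x, hx, hxw⟩, -⟩ := mem_clusterBoundary.1 hw
    have h₃ : 0 < (G.fiveNeighbors w).card :=
      Finset.card_pos.2 ⟨x, mem_fiveNeighbors.2 ⟨hxw.symm, degree_of_mem_fiveCluster hv hx⟩⟩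
    have h₃' : ((G.fiveNeighbors w).card : ℚ) ≠ 0 := by positivity
    rw [Finset.sum_const, nsmul_eq_mul]
    field_simp

theorem sum_charge_nonneg (h : G.IsReduced) : 0 ≤ ∑ v, charge G v := by
  set D : Finset V := Finset.univ.filter fun v => G.degree v = 5 with hD
  have hsplit := Finset.sum_filter_add_sum_filter_not Finset.univ (fun v => G.degree v = 5)
    (charge G)
  have h₁ : ∑ v ∈ D, charge G v = ∑ v ∈ D, (-4) := by
    refine Finset.sum_congr rfl fun v hv => ?_
    rw [hD, Finset.mem_filter] at hv
    rw [charge, hv.2]; norm_num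
  have h₂ : ∑ v ∈ D, received G v ≤
      ∑ w ∈ Finset.univ.filter (fun v => ¬ G.degree v = 5), charge G w := by
    have : ∑ v ∈ D, received G v = ∑ w ∈ Finset.univ.filter (fun v => ¬ G.degree v = 5),
        ∑ u ∈ G.fiveNeighbors w, charge G w / (G.fiveNeighbors w).card := by
      unfold received
      refine Finset.sum_comm' fun u w => ?_
      simp only [hD, Finset.mem_filter, mem_neighborFinset, mem_fiveNeighbors, G.adj_comm u w]
      simp
      tauto
    rw [this]
    refine Finset.sum_le_sum fun w hw => ?_
    rw [Finset.mem_filter] at hw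
    have := h.three_le_charge hw.2
    rw [Finset.sum_const, nsmul_eq_mul]
    rcases Nat.eq_zero_or_pos (G.fiveNeighbors w).card with h0 | h0
    · rw [h0]; simp; linarith
    · have h₃' : ((G.fiveNeighbors w).card : ℚ) ≠ 0 := by positivity
      field_simp
      exact le_rfl
  have h₃ : 0 ≤ ∑ v ∈ D, (received G v + (-4)) := by
    -- The fibres of `G.fiveCluster` on `D` are the clusters themselves.
    rw [← Finset.sum_fiberwise_of_maps_to (g := G.fiveCluster) (t := D.image G.fiveCluster)
      fun v hv => Finset.mem_image_of_mem _ hv]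
    refine Finset.sum_nonneg fun k hk => ?_
    obtain ⟨v, hv, rfl⟩ := Finset.mem_image.1 hk
    rw [hD, Finset.mem_filter] at hv
    have hfib : D.filter (fun u => G.fiveCluster u = G.fiveCluster v) = G.fiveCluster v := by
      ext u
      simp only [hD, Finset.mem_filter, Finset.mem_univ, true_and]
      constructor
      · rintro ⟨-, hu⟩
        rw [← hu]
        simp [fiveCluster]
      · exact fun hu => ⟨degree_of_mem_fiveCluster hv.2 hu, h.fiveCluster_eq hv.2 hu⟩
    rw [hfib, Finset.sum_add_distrib, Finset.sum_const, nsmul_eq_mul]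
    linarith [h.four_mul_card_le_sum_received hv.2]
  rw [Finset.sum_add_distrib] at h₃
  rw [← hsplit, h₁]
  linarith

end IsReduced

end SimpleGraph

/-! ### The neighbourhood of a vertex of degree six -/

namespace SimpleGraph

variable {V : Type*} [Fintype V] [DecidableEq V] {G : SimpleGraph V} [DecidableRel G.Adj]

/-- In a planar graph, two neighbours of a vertex `v` have at most two common neighbours among the
neighbours of `v`. -/
theorem card_inter_le_two_of_common_neighbor (h : HasEvenCrossings G) {v p q : V} {S : Finset V}
    (hS : ∀ x ∈ S, G.Adj v x) (hp : p ∈ S) (hq : q ∈ S) (hpq : p ≠ q) :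
    ((G.neighborFinset p ∩ G.neighborFinset q) ∩ S).card ≤ 2 := by
  by_contra! hc
  obtain ⟨B, hB, hB3⟩ := Finset.exists_subset_card_eq (show 3 ≤ _ from hc)
  refine h.not_K33_finset (A := {p, q, v}) (B := B)
    (Finset.card_eq_three.2 ⟨p, q, v, hpq, (hS p hp).ne', (hS q hq).ne', rfl⟩) hB3 ?_
  intro x hx y hy
  have := hB hy
  simp only [Finset.mem_inter, mem_neighborFinset] at this
  simp only [Finset.mem_insert, Finset.mem_singleton] at hx
  rcases hx with rfl | rfl | rfl
  exacts [this.1.1, this.1.2, hS y this.2]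

theorem card_add_card_le_card_inter (p q : V) {R T : Finset V}
    (hT : (G.neighborFinset p ∪ G.neighborFinset q) ∩ R ⊆ T) :
    (G.neighborFinset p ∩ R).card + (G.neighborFinset q ∩ R).card ≤
      ((G.neighborFinset p ∩ G.neighborFinset q) ∩ R).card + T.card := by
  have := Finset.card_union_add_card_inter (G.neighborFinset p ∩ R) (G.neighborFinset q ∩ R)
  rw [← Finset.union_inter_distrib_right, ← Finset.inter_inter_distrib_right] at this
  have := Finset.card_le_card hT
  omega

/-- No two of five vertices have three common neighbours among them: at most seven edges. -/
theorem sum_card_inter_lt_of_card_eq_five {R : Finset V} (hR : R.card = 5)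
    (hstar : ∀ p ∈ R, ∀ q ∈ R, p ≠ q →
      ((G.neighborFinset p ∩ G.neighborFinset q) ∩ R).card ≤ 2) :
    ∑ p ∈ R, (G.neighborFinset p ∩ R).card < 16 := by
  by_contra! hsum
  have h₇ : ∀ p ∈ R, ∀ q ∈ R, p ≠ q →
      (G.neighborFinset p ∩ R).card + (G.neighborFinset q ∩ R).card ≤ 7 := fun p hp q hq hpq => by
    have h₁ := hstar p hp q hq hpq
    have h₂ := card_add_card_le_card_inter (G := G) p q (R := R) Finset.inter_subset_right
    omega
  by_cases hadj : ∀ p ∈ R, ∀ q ∈ R, p ≠ q → G.Adj p q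
  · obtain ⟨p, hp, q, hq, hpq⟩ := Finset.one_lt_card.1 (show 1 < R.card by omega)
    have h₄ : ∀ x ∈ R, 4 ≤ (G.neighborFinset x ∩ R).card := fun x hx => by
      rw [← show (R.erase x).card = 4 by rw [Finset.card_erase_of_mem hx, hR]]
      refine Finset.card_le_card fun y hy => ?_
      rw [Finset.mem_erase] at hy
      simpa using ⟨hadj x hx y hy.2 hy.1.symm, hy.2⟩
    have := h₇ p hp q hq hpq
    have := h₄ p hp
    have := h₄ q hq
    omega
  · push Not at hadj
    obtain ⟨a, ha, b, hb, hab, hn⟩ := hadj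
    have hb' : b ∈ R.erase a := Finset.mem_erase.2 ⟨hab.symm, hb⟩
    have hc : ((R.erase a).erase b).card = 3 := by
      rw [Finset.card_erase_of_mem hb', Finset.card_erase_of_mem ha, hR]
    -- The degrees of the non-adjacent `a`, `b` add up to at most `2 + 3`. Those of the other three
    -- have pairwise sums at most 7, hence total at most 10, and `5 + 10 < 16`.
    have h₅ := card_add_card_le_card_inter (G := G) a b (R := R) (T := (R.erase a).erase b) (by
      intro y hy
      simp only [Finset.mem_inter, Finset.mem_union, mem_neighborFinset] at hy
      simp only [Finset.mem_erase]
      refine ⟨?_, ?_, hy.2⟩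
      · rintro rfl
        exact hy.1.elim hn fun e => e.ne rfl
      · rintro rfl
        exact hy.1.elim (fun e => e.ne rfl) fun e => hn e.symm)
    rw [← Finset.add_sum_erase _ _ ha, ← Finset.add_sum_erase _ _ hb'] at hsum
    obtain ⟨c, d, e, hcd, hce, hde, he⟩ := Finset.card_eq_three.1 hc
    have hmem : ∀ x ∈ (R.erase a).erase b, x ∈ R := fun x hx =>
      (Finset.mem_erase.1 (Finset.mem_erase.1 hx).2).2
    have hcR := hmem c (by simp [he])
    have hdR := hmem d (by simp [he])
    have heR := hmem e (by simp [he])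
    rw [he, Finset.sum_insert (by simp [hcd, hce]), Finset.sum_pair hde] at hsum
    have := hstar a ha b hb hab
    have := h₇ c hcR d hdR hcd
    have := h₇ c hcR e heR hce
    have := h₇ d hdR e heR hde
    omega

/-- A set of five vertices that induces a graph of degree two induces a cycle. -/
theorem exists_cycle_of_card_eq_five {R : Finset V} (hR : R.card = 5)
    (h2 : ∀ p ∈ R, (G.neighborFinset p ∩ R).card = 2) :
    ∃ w₁ ∈ R, ∃ w₂ ∈ R, ∃ w₃ ∈ R, ∃ w₄ ∈ R, ∃ w₅ ∈ R, G.Adj w₁ w₂ ∧ G.Adj w₂ w₃ ∧ G.Adj w₃ w₄ ∧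
      G.Adj w₄ w₅ ∧ G.Adj w₅ w₁ ∧ w₁ ≠ w₃ ∧ w₁ ≠ w₄ ∧ w₂ ≠ w₄ ∧ w₂ ≠ w₅ ∧ w₃ ≠ w₅ := by
  have third : ∀ p ∈ R, ∀ x ∈ R, ∀ y ∈ R, ∀ z ∈ R, G.Adj p x → G.Adj p y → G.Adj p z → x ≠ y →
      x = z ∨ y = z := by
    intro p hp x hx y hy z hz hpx hpy hpz hxy
    by_contra! hn
    have : ({x, y, z} : Finset V) ⊆ G.neighborFinset p ∩ R := by
      intro w hw
      simp only [Finset.mem_insert, Finset.mem_singleton] at hw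
      rcases hw with rfl | rfl | rfl <;> simp [*]
    have := Finset.card_le_card this
    rw [h2 p hp, Finset.card_eq_three.2 ⟨x, y, z, hxy, hn.1, hn.2, rfl⟩] at this
    omega
  have other : ∀ p ∈ R, ∀ x, ∃ y ∈ R, G.Adj p y ∧ y ≠ x := by
    intro p hp x
    obtain ⟨y, hy, hyx⟩ := Finset.exists_mem_ne (s := G.neighborFinset p ∩ R)
      (by rw [h2 p hp]; norm_num) x
    simp only [Finset.mem_inter, mem_neighborFinset] at hy
    exact ⟨y, hy.2, hy.1, hyx⟩
  have outside : ∀ s : Finset V, s.card < 5 → ∃ y ∈ R, y ∉ s := fun s hs =>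
    Finset.exists_mem_notMem_of_card_lt_card (by omega)
  obtain ⟨w₁, h₁⟩ := Finset.card_pos.1 (show 0 < R.card by omega)
  obtain ⟨w₂, h₂, a₁₂, -⟩ := other w₁ h₁ w₁
  obtain ⟨w₅, h₅, a₁₅, n₂₅⟩ := other w₁ h₁ w₂
  obtain ⟨w₃, h₃, a₂₃, n₁₃⟩ := other w₂ h₂ w₁
  have nb₁ : ∀ z ∈ R, G.Adj w₁ z → w₂ = z ∨ w₅ = z := fun z hz e =>
    third w₁ h₁ w₂ h₂ w₅ h₅ z hz a₁₂ a₁₅ e n₂₅.symm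
  have nb₂ : ∀ z ∈ R, G.Adj w₂ z → w₁ = z ∨ w₃ = z := fun z hz e =>
    third w₂ h₂ w₁ h₁ w₃ h₃ z hz a₁₂.symm a₂₃ e n₁₃.symm
  -- A triangle leaves two vertices, too few for a vertex and its two neighbours.
  have n₃₅ : w₃ ≠ w₅ := by
    rintro rfl
    obtain ⟨x, hx, hx'⟩ := outside {w₁, w₂, w₃} (Finset.card_le_three.trans_lt (by norm_num))
    obtain ⟨y, hy, hxy, -⟩ := other x hx x
    obtain ⟨z, hz, hxz, hzy⟩ := other x hx y
    have key : ∀ t ∈ R, G.Adj x t → t ∉ ({w₁, w₂, w₃} : Finset V) := by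
      intro t ht hxt htw
      simp only [Finset.mem_insert, Finset.mem_singleton, not_or] at htw hx'
      rcases htw with rfl | rfl | rfl
      · rcases nb₁ x hx hxt.symm with e | e
        exacts [hx'.2.1 e.symm, hx'.2.2 e.symm]
      · rcases nb₂ x hx hxt.symm with e | e
        exacts [hx'.1 e.symm, hx'.2.2 e.symm]
      · rcases third t h₃ w₁ h₁ w₂ h₂ x hx a₁₅.symm a₂₃.symm hxt.symm a₁₂.ne with e | e
        exacts [hx'.1 e.symm, hx'.2.1 e.symm]
    have hy' := key y hy hxy
    have hz' := key z hz hxz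
    have hsub : ({w₁, w₂, w₃, x, y, z} : Finset V) ⊆ R := by
      intro t ht
      simp only [Finset.mem_insert, Finset.mem_singleton] at ht
      rcases ht with rfl | rfl | rfl | rfl | rfl | rfl <;> assumption
    have hcard := Finset.card_le_card hsub
    simp only [Finset.mem_insert, Finset.mem_singleton, not_or] at hx' hy' hz'
    have : ({w₁, w₂, w₃, x, y, z} : Finset V).card = 6 := by
      have := hxy.ne
      have := hxz.ne
      have := a₁₂.ne
      have := a₂₃.ne
      simp [n₁₃.symm, hzy.symm, Ne.symm hx'.1, Ne.symm hx'.2.1, Ne.symm hx'.2.2, Ne.symm hy'.1,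
        Ne.symm hy'.2.1, Ne.symm hy'.2.2, Ne.symm hz'.1, Ne.symm hz'.2.1, Ne.symm hz'.2.2, *]
    omega
  obtain ⟨w₄, h₄, a₃₄, n₂₄⟩ := other w₃ h₃ w₂
  have nb₃ : ∀ z ∈ R, G.Adj w₃ z → w₂ = z ∨ w₄ = z := fun z hz e =>
    third w₃ h₃ w₂ h₂ w₄ h₄ z hz a₂₃.symm a₃₄ e n₂₄.symm
  have n₁₄ : w₁ ≠ w₄ := by
    rintro rfl
    rcases nb₁ w₃ h₃ a₃₄.symm with e | e
    exacts [a₂₃.ne e, n₃₅ e.symm]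
  -- A closed 4-cycle leaves one vertex, which would have no neighbour.
  have n₄₅ : w₄ ≠ w₅ := by
    rintro rfl
    obtain ⟨x, hx, hx'⟩ := outside {w₁, w₂, w₃, w₄} (Finset.card_le_four.trans_lt (by norm_num))
    simp only [Finset.mem_insert, Finset.mem_singleton, not_or] at hx'
    obtain ⟨y, hy, hxy, -⟩ := other x hx x
    have hsub : ({w₁, w₂, w₃, w₄, x} : Finset V) = R := by
      refine Finset.eq_of_subset_of_card_le ?_ ?_
      · intro t ht
        simp only [Finset.mem_insert, Finset.mem_singleton] at ht
        rcases ht with rfl | rfl | rfl | rfl | rfl <;> assumption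
      · have : ({w₁, w₂, w₃, w₄, x} : Finset V).card = 5 := by
          have := a₁₂.ne
          have := a₂₃.ne
          have := a₃₄.ne
          simp [n₁₃.symm, n₂₄.symm, Ne.symm hx'.1, Ne.symm hx'.2.1, Ne.symm hx'.2.2.1,
            Ne.symm hx'.2.2.2, *]
        omega
    rw [← hsub] at hy
    simp only [Finset.mem_insert, Finset.mem_singleton] at hy
    rcases hy with rfl | rfl | rfl | rfl | rfl
    · rcases nb₁ x hx hxy.symm with e | e
      exacts [hx'.2.1 e.symm, hx'.2.2.2 e.symm]
    · rcases nb₂ x hx hxy.symm with e | e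
      exacts [hx'.1 e.symm, hx'.2.2.1 e.symm]
    · rcases nb₃ x hx hxy.symm with e | e
      exacts [hx'.2.1 e.symm, hx'.2.2.2 e.symm]
    · rcases third y h₄ w₁ h₁ w₃ h₃ x hx a₁₅.symm a₃₄.symm hxy.symm n₁₃.symm with e | e
      exacts [hx'.1 e.symm, hx'.2.2.1 e.symm]
    · exact hxy.ne rfl
  obtain ⟨x, hx, a₄x, nx₃⟩ := other w₄ h₄ w₃
  have hx5 : x = w₅ := by
    by_contra hx5
    have x₁ : x ≠ w₁ := by
      rintro rfl
      rcases nb₁ w₄ h₄ a₄x.symm with e | e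
      exacts [n₂₄ e.symm, n₄₅ e.symm]
    have x₂ : x ≠ w₂ := by
      rintro rfl
      rcases nb₂ w₄ h₄ a₄x.symm with e | e
      exacts [n₁₄ e, a₃₄.ne e]
    have : ({w₁, w₂, w₃, w₄, w₅, x} : Finset V).card = 6 := by
      have := a₁₂.ne
      have := a₂₃.ne
      have := a₃₄.ne
      have := a₁₅.ne
      have := a₄x.ne
      simp [n₁₃.symm, n₂₄.symm, n₂₅.symm, x₁.symm, x₂.symm, nx₃.symm, Ne.symm hx5, *]
    have hsub : ({w₁, w₂, w₃, w₄, w₅, x} : Finset V) ⊆ R := by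
      intro t ht
      simp only [Finset.mem_insert, Finset.mem_singleton] at ht
      rcases ht with rfl | rfl | rfl | rfl | rfl | rfl <;> assumption
    have := Finset.card_le_card hsub
    omega
  subst hx5
  exact ⟨w₁, h₁, w₂, h₂, w₃, h₃, w₄, h₄, x, hx, a₁₂, a₂₃, a₃₄, a₄x, a₁₅.symm, n₁₃.symm, n₁₄,
    n₂₄.symm, n₂₅.symm, n₃₅⟩

/-- The neighbourhood of a vertex of degree six in a planar graph induces at most nine edges. -/
theorem sum_card_inter_lt_of_card_eq_six (h : HasEvenCrossings G) {v : V} {S : Finset V}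
    (hS : ∀ x ∈ S, G.Adj v x) (hS6 : S.card = 6) :
    ∑ p ∈ S, (G.neighborFinset p ∩ S).card < 20 := by
  by_contra! hsum
  have hstar : ∀ p ∈ S, ∀ q ∈ S, p ≠ q →
      ((G.neighborFinset p ∩ G.neighborFinset q) ∩ S).card ≤ 2 := fun p hp q hq hpq =>
    card_inter_le_two_of_common_neighbor h hS hp hq hpq
  by_cases h₂ : ∃ y ∈ S, (G.neighborFinset y ∩ S).card ≤ 2
  · obtain ⟨y, hy, hy2⟩ := h₂
    have h₅ := sum_card_inter_lt_of_card_eq_five (G := G) (R := S.erase y)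
      (by rw [Finset.card_erase_of_mem hy, hS6]) fun p hp q hq hpq =>
        (Finset.card_le_card (Finset.inter_subset_inter_left (Finset.erase_subset y S))).trans
          (hstar p (Finset.mem_of_mem_erase hp) q (Finset.mem_of_mem_erase hq) hpq)
    rw [← Finset.add_sum_erase _ _ hy] at hsum
    have h₆ : ∑ p ∈ S.erase y, (G.neighborFinset p ∩ S).card ≤
        ∑ p ∈ S.erase y, ((G.neighborFinset p ∩ S.erase y).card + if G.Adj p y then 1 else 0) := by
      refine Finset.sum_le_sum fun p hp => ?_
      rw [Finset.inter_erase]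
      split_ifs with e
      · have := Finset.pred_card_le_card_erase (s := G.neighborFinset p ∩ S) (a := y)
        omega
      · rw [Finset.erase_eq_of_notMem (by simp [e])]; rfl
    have h₇ : ∑ p ∈ S.erase y, (if G.Adj p y then 1 else 0) = (G.neighborFinset y ∩ S).card := by
      rw [← Finset.card_filter]
      congr 1
      ext p
      simp only [Finset.mem_filter, Finset.mem_erase, Finset.mem_inter, mem_neighborFinset]
      exact ⟨fun e => ⟨e.2.symm, e.1.2⟩, fun e => ⟨⟨e.1.ne', e.2⟩, e.1.symm⟩⟩
    rw [Finset.sum_add_distrib, h₇] at h₆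
    omega
  push Not at h₂
  have hsubE : ∀ x, G.neighborFinset x ∩ S ⊆ S.erase x := fun x y hy => by
    simp only [Finset.mem_inter, mem_neighborFinset] at hy
    exact Finset.mem_erase.2 ⟨hy.1.ne', hy.2⟩
  by_cases h₅ : ∃ x ∈ S, 5 ≤ (G.neighborFinset x ∩ S).card
  · obtain ⟨x, hx, hx5⟩ := h₅
    have hN : G.neighborFinset x ∩ S = S.erase x := Finset.eq_of_subset_of_card_le (hsubE x)
      (by rw [Finset.card_erase_of_mem hx, hS6]; exact hx5)
    have hxa : ∀ y ∈ S.erase x, G.Adj x y := fun y hy => by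
      rw [← hN] at hy
      simpa using (Finset.mem_inter.1 hy).1
    -- Off `x`, each of the other five vertices has degree at least `3 - 1`, and at most 2 as these
    -- neighbours are shared with `x`. So they form a 5-cycle joined to the two adjacent hubs `x`
    -- and `v`.
    obtain ⟨w₁, m₁, w₂, m₂, w₃, m₃, w₄, m₄, w₅, m₅, a₁₂, a₂₃, a₃₄, a₄₅, a₅₁, n₁₃, n₁₄, n₂₄, n₂₅,
        n₃₅⟩ := exists_cycle_of_card_eq_five (G := G) (R := S.erase x)
        (by rw [Finset.card_erase_of_mem hx, hS6]) (by
      intro p hp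
      have hpS := Finset.mem_of_mem_erase hp
      have h₁ : G.neighborFinset p ∩ S.erase x = (G.neighborFinset x ∩ G.neighborFinset p) ∩ S := by
        rw [← hN]
        ext; simp; tauto
      have := hstar x hx p hpS (Finset.ne_of_mem_erase hp).symm
      have := h₂ p hpS
      have := Finset.pred_card_le_card_erase (s := G.neighborFinset p ∩ S) (a := x)
      rw [Finset.inter_erase] at *
      rw [← h₁] at *
      omega)
    have hv : ∀ y ∈ S.erase x, G.Adj v y := fun y hy => hS y (Finset.mem_of_mem_erase hy)
    -- The only missing edge, from `w₁` to `w₄`, is replaced by the path through `w₅`.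
    refine h.not_subdivided_K33 (a := ![w₁, v, w₃]) (b := ![w₄, x, w₂]) (x := w₅) ?_ ?_ ?_ ?_ ?_ ?_
      a₅₁.symm a₄₅.symm
    · intro i j hij
      have := (hv _ m₁).ne
      have := (hv _ m₃).ne
      fin_cases i <;> fin_cases j <;> simp_all
    · intro i j hij
      have := (hxa _ m₄).ne
      have := (hxa _ m₂).ne
      fin_cases i <;> fin_cases j <;> simp_all
    · intro i j
      fin_cases i <;> fin_cases j
      exacts [n₁₄, (hxa _ m₁).ne', a₁₂.ne, (hv _ m₄).ne, (hS _ hx).ne, (hv _ m₂).ne, a₃₄.ne,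
        (hxa _ m₃).ne', a₂₃.ne']
    · intro i j hij
      fin_cases i <;> fin_cases j
      exacts [absurd rfl hij, (hxa _ m₁).symm, a₁₂, hv _ m₄, hS _ hx, hv _ m₂, a₃₄,
        (hxa _ m₃).symm, a₂₃.symm]
    · intro i
      fin_cases i
      exacts [a₅₁.ne', (hv _ m₅).ne, n₃₅]
    · intro j
      fin_cases j
      exacts [a₄₅.ne, (hxa _ m₅).ne, n₂₅]
  · push Not at h₅
    obtain ⟨x, hx, hx4⟩ : ∃ x ∈ S, 4 ≤ (G.neighborFinset x ∩ S).card := by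
      by_contra! hn
      have := Finset.sum_le_card_nsmul S _ 3 fun p hp => Nat.le_of_lt_succ (hn p hp)
      rw [hS6, smul_eq_mul] at this
      omega
    have hx5 := h₅ x hx
    -- The single non-neighbour `z` of `x` has at least three neighbours in `S`, all shared with
    -- `x`.
    obtain ⟨z, hz, hz'⟩ : ∃ z ∈ S.erase x, z ∉ G.neighborFinset x ∩ S :=
      Finset.exists_mem_notMem_of_card_lt_card (by
        rw [Finset.card_erase_of_mem hx, hS6]; omega)
    have hN : G.neighborFinset x ∩ S = (S.erase x).erase z := by
      refine Finset.eq_of_subset_of_card_le ?_ ?_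
      · intro y hy
        refine Finset.mem_erase.2 ⟨?_, hsubE x hy⟩
        rintro rfl
        exact hz' hy
      · rw [Finset.card_erase_of_mem hz, Finset.card_erase_of_mem hx, hS6]
        exact hx4
    rw [Finset.mem_erase] at hz
    have h₃ := h₂ z hz.2
    have h₄ := hstar x hx z hz.2 hz.1.symm
    have h₆ : G.neighborFinset z ∩ S ⊆ (G.neighborFinset x ∩ G.neighborFinset z) ∩ S := by
      intro y hy
      have hy' := hsubE z hy
      have hyx : y ∈ G.neighborFinset x ∩ S := by
        rw [hN]
        simp only [Finset.mem_erase] at hy' ⊢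
        refine ⟨hy'.1, ?_, hy'.2⟩
        rintro rfl
        simp only [Finset.mem_inter, mem_neighborFinset] at hy hz'
        exact hz' ⟨hy.1.symm, hz.2⟩
      simp only [Finset.mem_inter] at *
      exact ⟨⟨hyx.1, hy.1⟩, hy.2⟩
    have := Finset.card_le_card h₆
    omega

end SimpleGraph

/-! ### Induction for the upper bound -/

namespace SimpleGraph

open scoped Classical in
-- Deleting `C` also lowers the degrees outside, once for every edge that leaves `C`.
theorem sum_degree_eq_sum_degree_induce_compl {V : Type*} [Fintype V] (G : SimpleGraph V)
    (C : Finset V) :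
    ∑ v, G.degree v = ∑ v : ↥((C : Set V)ᶜ), (G.induce (C : Set V)ᶜ).degree v +
      ∑ c ∈ C, (G.degree c + (G.neighborFinset c \ C).card) := by
  have h₁ : ∀ v : ↥((C : Set V)ᶜ), (G.induce (C : Set V)ᶜ).degree v =
      (G.neighborFinset v.1 \ C).card := fun v => by
    rw [← card_neighborFinset_eq_degree, ← Finset.card_map (Function.Embedding.subtype _),
      map_neighborFinset_induce]
    congr 1
    ext; simp
  have h₂ : ∑ v : ↥((C : Set V)ᶜ), (G.neighborFinset v.1 \ C).card =
      ∑ v ∈ Cᶜ, (G.neighborFinset v \ C).card :=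
    (Finset.sum_subtype Cᶜ (by simp) fun v => (G.neighborFinset v \ C).card).symm
  have h₃ : ∑ c ∈ C, (G.neighborFinset c \ C).card = ∑ v ∈ Cᶜ, (G.neighborFinset v ∩ C).card := by
    simp only [Finset.card_eq_sum_ones]
    refine Finset.sum_comm' fun x y => ?_
    simp only [Finset.mem_sdiff, mem_neighborFinset, Finset.mem_inter, Finset.mem_compl,
      G.adj_comm x y]
    tauto
  rw [Finset.sum_congr rfl fun v _ => h₁ v, h₂, Finset.sum_add_distrib, h₃,
    ← Finset.sum_add_sum_compl C fun v => G.degree v]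
  have h₄ : ∑ v ∈ Cᶜ, G.degree v =
      ∑ v ∈ Cᶜ, ((G.neighborFinset v \ C).card + (G.neighborFinset v ∩ C).card) :=
    Finset.sum_congr rfl fun v _ => by
      rw [Finset.card_sdiff_add_card_inter, card_neighborFinset_eq_degree]
  rw [h₄, Finset.sum_add_distrib]
  omega

open scoped Classical in
theorem seven_mul_sum_degree_le {V : Type*} [Fintype V] (G : SimpleGraph V)
    (hG : HasEvenCrossings G) (hF : (doubleStar 2 4).Free G) :
    7 * ∑ v, G.degree v ≤ 31 * Fintype.card V := by
  induction hn : Fintype.card V using Nat.strong_induction_on generalizing V with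
  | _ n ih =>
  subst hn
  have remove : ∀ C : Finset V, C.Nonempty →
      7 * ∑ c ∈ C, (G.degree c + (G.neighborFinset c \ C).card) ≤ 31 * C.card →
      7 * ∑ v, G.degree v ≤ 31 * Fintype.card V := by
    intro C hC hle
    have hcard : Fintype.card ↥((C : Set V)ᶜ) = Fintype.card V - C.card := by
      rw [Fintype.card_compl_set]; simp
    have hCV := Finset.card_le_univ C
    have hC0 := hC.card_pos
    have : 7 * ∑ v : ↥((C : Set V)ᶜ), (G.induce (C : Set V)ᶜ).degree v ≤
        31 * Fintype.card ↥((C : Set V)ᶜ) := by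
      convert ih _ (by rw [hcard]; omega) (G.induce (C : Set V)ᶜ)
        (hG.comap (Function.Embedding.subtype _) fun u v h => h)
        (fun h => hF (h.trans ⟨Copy.induce G _⟩)) rfl
    rw [sum_degree_eq_sum_degree_induce_compl G C]
    rw [hcard] at this
    omega
  by_cases h₂ : ∃ y, G.degree y ≤ 2
  · obtain ⟨y, hy⟩ := h₂
    refine remove {y} (Finset.singleton_nonempty y) ?_
    have := Finset.card_le_card (Finset.sdiff_subset (s := G.neighborFinset y) (t := {y}))
    rw [card_neighborFinset_eq_degree] at this
    rw [Finset.sum_singleton, Finset.card_singleton]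
    omega
  push Not at h₂
  have h₆ : ∀ v, G.degree v ≤ 6 := by
    intro v
    by_contra! hv
    obtain ⟨u, hu⟩ := Finset.card_pos.1 (show 0 < (G.neighborFinset v).card by
      rw [card_neighborFinset_eq_degree]; omega)
    rw [mem_neighborFinset] at hu
    have := degree_le_two_of_adj hF hu.symm hv
    have := h₂ u
    omega
  by_cases h₅ : ∃ v, 6 ≤ G.degree v
  · obtain ⟨v, hv⟩ := h₅
    have hv6 := (h₆ v).antisymm hv
    have hvn : v ∉ G.neighborFinset v := by simp
    have hcl : ∀ u, G.Adj v u → G.neighborFinset u ⊆ insert v (G.neighborFinset v) := fun u hu =>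
      neighborFinset_subset_of_adj hF hu.symm hv (h₂ u)
    -- No edge leaves these seven vertices. Their degree sum is at most `6 + 6 + 19 = 31`, exactly
    -- what is allowed.
    refine remove (insert v (G.neighborFinset v)) (Finset.insert_nonempty _ _) ?_
    have h₀ : ∀ c ∈ insert v (G.neighborFinset v),
        (G.neighborFinset c \ insert v (G.neighborFinset v)).card = 0 := by
      intro c hc
      rw [Finset.card_eq_zero, Finset.sdiff_eq_empty_iff_subset]
      rw [Finset.mem_insert, mem_neighborFinset] at hc
      rcases hc with rfl | hc
      · exact Finset.subset_insert _ _
      · exact hcl c hc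
    rw [Finset.sum_congr rfl fun c hc => by rw [h₀ c hc, add_zero], Finset.sum_insert hvn,
      Finset.card_insert_of_notMem hvn, card_neighborFinset_eq_degree, hv6]
    have h₁ : ∑ u ∈ G.neighborFinset v, G.degree u ≤
        ∑ u ∈ G.neighborFinset v, ((G.neighborFinset u ∩ G.neighborFinset v).card + 1) := by
      refine Finset.sum_le_sum fun u hu => ?_
      rw [mem_neighborFinset] at hu
      rw [← card_neighborFinset_eq_degree]
      refine (Finset.card_le_card (t := insert v (G.neighborFinset u ∩ G.neighborFinset v))
        fun x hx => ?_).trans (Finset.card_insert_le _ _)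
      have := hcl u hu hx
      simp only [Finset.mem_insert, Finset.mem_inter] at this ⊢
      tauto
    have h₃ := sum_card_inter_lt_of_card_eq_six hG (v := v) (S := G.neighborFinset v) (by simp)
      (by rw [card_neighborFinset_eq_degree, hv6])
    rw [Finset.sum_add_distrib, Finset.sum_const, card_neighborFinset_eq_degree, hv6] at h₁
    simp only [smul_eq_mul] at h₁
    omega
  · push Not at h₅
    have hR : G.IsReduced := ⟨h₂, fun v => Nat.le_of_lt_succ (h₅ v),
      fun huv hv => card_neighborFinset_sdiff_le_one hF huv hv.ge, hG⟩
    have := hR.sum_charge_nonneg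
    simp only [IsReduced.charge, Finset.sum_sub_distrib, ← Finset.mul_sum, Finset.sum_const,
      Finset.card_univ, nsmul_eq_mul] at this
    have h₁ : (7 * ∑ v, (G.degree v : ℚ)) ≤ 31 * Fintype.card V := by linarith
    exact_mod_cast h₁

theorem ncard_edgeSet_le {V : Type*} [Fintype V] (G : SimpleGraph V) (hG : IsPlanarGraph G)
    (hF : (doubleStar 2 4).Free G) :
    (G.edgeSet.ncard : ℝ) ≤ 31 / 14 * (Fintype.card V : ℝ) := by
  classical
  have h₁ := seven_mul_sum_degree_le G hG.hasEvenCrossings hF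
  rw [sum_degrees_eq_twice_card_edges, ← coe_edgeFinset G, Set.ncard_coe_finset] at *
  have h₂ : ((7 * (2 * G.edgeFinset.card) : ℕ) : ℝ) ≤ ((31 * Fintype.card V : ℕ) : ℝ) := by
    exact_mod_cast h₁
  push_cast at h₂
  linarith

end SimpleGraph

/-! ### Straight-line drawings -/

theorem isPolygonalArc_segment {x y : ℝ × ℝ} (h : x ≠ y) : IsPolygonalArc (segment ℝ x y) x y := by
  refine ⟨1, fun i => if i = 0 then x else y, le_rfl, by simp, by simp, ?_, by omega, by omega, ?_⟩
  · intro i hi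
    obtain rfl : i = 0 := by omega
    simpa using h
  · simp

/-- The points `f v` form a straight-line drawing of the graph `G` without crossings. -/
structure IsStraightDrawing {V : Type*} (G : SimpleGraph V) (f : V → ℝ × ℝ) : Prop where
  injective : Function.Injective f
  eq_or_eq_of_mem : ∀ {u v w}, G.Adj u v → f w ∈ segment ℝ (f u) (f v) → w = u ∨ w = v
  exists_of_mem : ∀ {u v w z x}, G.Adj u v → G.Adj w z → s(u, v) ≠ s(w, z) →
    x ∈ segment ℝ (f u) (f v) → x ∈ segment ℝ (f w) (f z) → ∃ y, y ∈ s(u, v) ∧ y ∈ s(w, z) ∧ f y = x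

theorem IsStraightDrawing.isPlanarGraph {V : Type*} {G : SimpleGraph V} {f : V → ℝ × ℝ}
    (h : IsStraightDrawing G f) : IsPlanarGraph G :=
  ⟨{ point := f
     curve := Sym2.lift ⟨fun u v => segment ℝ (f u) (f v), fun u v => segment_symm ℝ (f u) (f v)⟩
     point_injective := h.injective
     isPolygonalArc_curve := fun u v huv => isPolygonalArc_segment (h.injective.ne huv.ne)
     mem_of_point_mem := by
       intro e
       induction e with | _ u v
       intro he w hw
       rw [Sym2.mem_iff]
       exact h.eq_or_eq_of_mem he hw
     curve_inter_subset := by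
       intro e
       induction e with | _ u v
       intro he f'
       induction f' with | _ w z
       rintro hf hne x ⟨hx, hx'⟩
       obtain ⟨y, hy, hy', rfl⟩ := h.exists_of_mem he hf hne hx hx'
       exact ⟨y, ⟨hy, hy'⟩, rfl⟩ }⟩

theorem IsStraightDrawing.comap {V W : Type*} {G : SimpleGraph V} {f : V → ℝ × ℝ}
    (h : IsStraightDrawing G f) (e : W ↪ V) : IsStraightDrawing (G.comap e) (f ∘ e) := by
  refine ⟨h.injective.comp e.injective, fun huv hw => ?_, fun {u v w z x} huv hwz hne hx hx' => ?_⟩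
  · exact (h.eq_or_eq_of_mem huv hw).imp (fun h => e.injective h) fun h => e.injective h
  · obtain ⟨y, hy, hy', hyx⟩ := h.exists_of_mem huv hwz
      (fun he => hne (Sym2.map.injective e.injective he)) hx hx'
    rw [Sym2.mem_iff] at hy
    obtain ⟨t, rfl⟩ : ∃ t, e t = y := by
      rcases hy with rfl | rfl
      exacts [⟨u, rfl⟩, ⟨v, rfl⟩]
    refine ⟨t, ?_, ?_, hyx⟩
    · rw [Sym2.mem_iff]
      exact hy.imp (fun h => e.injective h) fun h => e.injective h
    · rw [Sym2.mem_iff] at hy' ⊢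
      exact hy'.imp (fun h => e.injective h) fun h => e.injective h

theorem add_mem_segment_add {p q x t : ℝ × ℝ} :
    x ∈ segment ℝ (t + p) (t + q) ↔ x - t ∈ segment ℝ p q := by
  rw [← mem_segment_translate ℝ t (x := x - t), add_sub_cancel]

theorem IsStraightDrawing.exists_sum {V W : Type*} [Finite V] [Finite W] {G : SimpleGraph V}
    {H : SimpleGraph W} {f : V → ℝ × ℝ} {g : W → ℝ × ℝ} (hf : IsStraightDrawing G f)
    (hg : IsStraightDrawing H g) : ∃ k, IsStraightDrawing (G ⊕g H) k := by
  obtain ⟨b, hb⟩ := (Set.finite_range fun v => (f v).1).bddAbove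
  obtain ⟨a, ha⟩ := (Set.finite_range fun w => (g w).1).bddBelow
  have hb' : ∀ v, (f v).1 ≤ b := fun v => hb ⟨v, rfl⟩
  have ha' : ∀ w, a ≤ (g w).1 := fun w => ha ⟨w, rfl⟩
  -- This shift moves the second drawing into the half-plane to the right of abscissa `b + 1`.
  set t : ℝ × ℝ := (b - a + 1, 0) with ht
  have left : ∀ {u v x}, x ∈ segment ℝ (f u) (f v) → x.1 ≤ b := fun {u v x} hx =>
    ((convex_Iic b).linear_preimage (LinearMap.fst ℝ ℝ ℝ)).segment_subset (hb' u) (hb' v) hx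
  have right : ∀ {u v x}, x ∈ segment ℝ (t + g u) (t + g v) → b + 1 ≤ x.1 := fun {u v x} hx => by
    have h₁ : ∀ w, b + 1 ≤ (t + g w).1 := fun w => by
      have := ha' w
      simp only [ht, Prod.fst_add]
      linarith
    exact ((convex_Ici (b + 1)).linear_preimage (LinearMap.fst ℝ ℝ ℝ)).segment_subset
      (h₁ u) (h₁ v) hx
  refine ⟨Sum.elim f fun w => t + g w, ?_, ?_, ?_⟩
  · refine hf.injective.sumElim (fun u v h => hg.injective (add_left_cancel h)) fun v w h => ?_
    have h₁ := left (left_mem_segment ℝ (f v) (f v))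
    have h₂ := right (left_mem_segment ℝ (t + g w) (t + g w))
    rw [← h] at h₂
    linarith
  · rintro (u | u) (v | v) (w | w) huv hw <;> simp only [Sum.elim_inl, Sum.elim_inr] at hw
    · simpa using hf.eq_or_eq_of_mem (by simpa using huv) hw
    · have h₁ := left hw
      have h₂ := right (left_mem_segment ℝ (t + g w) (t + g w))
      linarith
    · simp at huv
    · simp at huv
    · simp at huv
    · simp at huv
    · have h₁ := left (left_mem_segment ℝ (f w) (f w))
      have h₂ := right hw
      linarith
    · rw [add_mem_segment_add, add_sub_cancel_left] at hw
      simpa using hg.eq_or_eq_of_mem (by simpa using huv) hw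
  · rintro (u | u) (v | v) (w | w) (z | z) x huv hwz hne hx hx' <;>
      simp only [SimpleGraph.sum_adj_inl, SimpleGraph.sum_adj_inr,
        SimpleGraph.not_adj_sum_inl_inr, SimpleGraph.adj_comm _ (Sum.inr _) (Sum.inl _)]
        at huv hwz <;> simp only [Sum.elim_inl, Sum.elim_inr] at hx hx'
    · obtain ⟨y, hy, hy', rfl⟩ := hf.exists_of_mem huv hwz
        (fun e => hne (congrArg (Sym2.map Sum.inl) e)) hx hx'
      refine ⟨.inl y, ?_, ?_, rfl⟩
      · simpa using hy
      · simpa using hy'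
    · have h₁ := left hx
      have h₂ := right hx'
      linarith
    · have h₁ := left hx'
      have h₂ := right hx
      linarith
    · rw [add_mem_segment_add] at hx hx'
      obtain ⟨y, hy, hy', hyx⟩ := hg.exists_of_mem huv hwz
        (fun e => hne (congrArg (Sym2.map Sum.inr) e)) hx hx'
      refine ⟨.inr y, ?_, ?_, ?_⟩
      · simpa using hy
      · simpa using hy'
      · simp [hyx]

theorem orient_of_mem_segment {p q r s x : ℝ × ℝ} (hx : x ∈ segment ℝ r s) :
    ∃ a b : ℝ, 0 ≤ a ∧ 0 ≤ b ∧ a + b = 1 ∧ a • r + b • s = x ∧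
      orient p q x = a * orient p q r + b * orient p q s := by
  obtain ⟨a, b, ha, hb, hab, rfl⟩ := hx
  refine ⟨a, b, ha, hb, hab, rfl, ?_⟩
  obtain rfl : a = 1 - b := by linarith
  simp only [orient, Prod.fst_add, Prod.snd_add, Prod.smul_fst, Prod.smul_snd, smul_eq_mul]
  ring

theorem orient_eq_zero_of_mem_segment {p q x : ℝ × ℝ} (hx : x ∈ segment ℝ p q) :
    orient p q x = 0 := by
  obtain ⟨a, b, -, -, -, -, h⟩ := orient_of_mem_segment (p := p) (q := q) hx
  rw [h]
  unfold orient
  ring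

theorem orient_ne_zero_of_mem_segment {p q r s x : ℝ × ℝ} (h : 0 < orient p q r * orient p q s)
    (hx : x ∈ segment ℝ r s) : orient p q x ≠ 0 := by
  obtain ⟨a, b, ha, hb, hab, -, e⟩ := orient_of_mem_segment (p := p) (q := q) hx
  rw [e]
  have key : ∀ {y z : ℝ}, 0 < y → 0 < z → 0 < a * y + b * z := by
    intro y z hy hz
    rcases ha.eq_or_lt with rfl | ha
    · obtain rfl : b = 1 := by linarith
      linarith
    · positivity
  rcases mul_pos_iff.1 h with ⟨h₁, h₂⟩ | ⟨h₁, h₂⟩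
  · exact (key h₁ h₂).ne'
  · have := key (neg_pos.2 h₁) (neg_pos.2 h₂)
    intro e
    linarith

theorem eq_of_mem_segment_of_mem_segment {p q r x : ℝ × ℝ} (h : orient p q r ≠ 0)
    (hx : x ∈ segment ℝ p q) (hx' : x ∈ segment ℝ p r) : x = p := by
  obtain ⟨a, b, ha, hb, hab, hxe, e⟩ := orient_of_mem_segment (p := p) (q := q) hx'
  rw [orient_eq_zero_of_mem_segment hx] at e
  have h₀ : orient p q p = 0 := by unfold orient; ring
  rw [h₀] at e
  have hb0 : b = 0 := by
    have : b * orient p q r = 0 := by linarith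
    exact (mul_eq_zero.1 this).resolve_right h
  subst hb0
  obtain rfl : a = 1 := by linarith
  simp [← hxe]

/-- The orientation of a triple of lattice points. -/
def latticeOrient (p q r : ℤ × ℤ) : ℤ := (q.1 - p.1) * (r.2 - p.2) - (q.2 - p.2) * (r.1 - p.1)

theorem latticeOrient_cast (p q r : ℤ × ℤ) :
    orient ((p.1 : ℝ), (p.2 : ℝ)) ((q.1 : ℝ), (q.2 : ℝ)) ((r.1 : ℝ), (r.2 : ℝ)) =
      (latticeOrient p q r : ℤ) := by
  unfold orient latticeOrient
  push_cast
  ring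

/-- The conditions on lattice points that ensure that they form a straight-line drawing. -/
theorem isStraightDrawing_of_lattice {V : Type*} [LinearOrder V] {G : SimpleGraph V} (f : V → ℤ × ℤ)
    (hinj : ∀ u v, f u = f v → u = v)
    (h₁ : ∀ u v, G.Adj u v → u < v → ∀ w, w = u ∨ w = v ∨ latticeOrient (f u) (f v) (f w) ≠ 0)
    (h₂ : ∀ u v, G.Adj u v → u < v → ∀ w z, G.Adj w z → w < z → u = w ∨ u = z ∨ v = w ∨ v = z ∨
      0 < latticeOrient (f u) (f v) (f w) * latticeOrient (f u) (f v) (f z) ∨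
      0 < latticeOrient (f w) (f z) (f u) * latticeOrient (f w) (f z) (f v)) :
    IsStraightDrawing G fun v => (((f v).1 : ℝ), ((f v).2 : ℝ)) := by
  set g : V → ℝ × ℝ := fun v => (((f v).1 : ℝ), ((f v).2 : ℝ)) with hg
  have hcast : ∀ u v w, orient (g u) (g v) (g w) = (latticeOrient (f u) (f v) (f w) : ℤ) :=
    fun u v w => latticeOrient_cast _ _ _
  have n₁ : ∀ u v w, G.Adj u v → w ≠ u → w ≠ v → orient (g u) (g v) (g w) ≠ 0 := by
    have key : ∀ u v w, G.Adj u v → u < v → w ≠ u → w ≠ v → orient (g u) (g v) (g w) ≠ 0 := by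
      intro u v w huv hlt hwu hwv
      rw [hcast]
      have := h₁ u v huv hlt w
      exact_mod_cast (this.resolve_left hwu).resolve_left hwv
    intro u v w huv hwu hwv
    rcases lt_or_gt_of_ne huv.ne with hlt | hlt
    · exact key u v w huv hlt hwu hwv
    · have := key v u w huv.symm hlt hwv hwu
      rwa [orient_swap, neg_ne_zero] at this
  have n₂ : ∀ u v w z x, G.Adj u v → G.Adj w z → u ≠ w → u ≠ z → v ≠ w → v ≠ z →
      x ∈ segment ℝ (g u) (g v) → x ∉ segment ℝ (g w) (g z) := by
    have key : ∀ u v w z x, G.Adj u v → u < v → G.Adj w z → w < z → u ≠ w → u ≠ z → v ≠ w →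
        v ≠ z → x ∈ segment ℝ (g u) (g v) → x ∉ segment ℝ (g w) (g z) := by
      intro u v w z x huv h hwz h' e₁ e₂ e₃ e₄ hx hx'
      have := h₂ u v huv h w z hwz h'
      rcases (((this.resolve_left e₁).resolve_left e₂).resolve_left e₃).resolve_left e₄ with h | h
      · refine orient_ne_zero_of_mem_segment (p := g u) (q := g v) ?_ hx'
          (orient_eq_zero_of_mem_segment hx)
        rw [hcast, hcast]
        exact_mod_cast h
      · refine orient_ne_zero_of_mem_segment (p := g w) (q := g z) ?_ hx
          (orient_eq_zero_of_mem_segment hx')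
        rw [hcast, hcast]
        exact_mod_cast h
    intro u v w z x huv hwz e₁ e₂ e₃ e₄ hx
    rcases lt_or_gt_of_ne huv.ne with h | h <;> rcases lt_or_gt_of_ne hwz.ne with h' | h'
    · exact key u v w z x huv h hwz h' e₁ e₂ e₃ e₄ hx
    · rw [segment_symm]
      exact key u v z w x huv h hwz.symm h' e₂ e₁ e₄ e₃ hx
    · rw [segment_symm] at hx
      exact key v u w z x huv.symm h hwz h' e₃ e₄ e₁ e₂ hx
    · rw [segment_symm] at hx ⊢
      exact key v u z w x huv.symm h hwz.symm h' e₄ e₃ e₂ e₁ hx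
  have n₃ : ∀ u v w x, G.Adj u v → G.Adj u w → v ≠ w → x ∈ segment ℝ (g u) (g v) →
      x ∈ segment ℝ (g u) (g w) → x = g u := fun u v w x huv huw hvw hx hx' =>
    eq_of_mem_segment_of_mem_segment (n₁ u v w huv huw.ne' hvw.symm) hx hx'
  refine ⟨fun u v h => hinj u v ?_, fun {u v w} huv hw => ?_,
    fun {u v w z x} huv hwz hne hx hx' => ?_⟩
  · simpa [hg, Prod.ext_iff] using h
  · by_contra! hn
    exact n₁ u v w huv hn.1 hn.2 (orient_eq_zero_of_mem_segment hw)
  · by_cases e₁ : u = w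
    · subst e₁
      exact ⟨u, by simp, by simp, (n₃ u v z x huv hwz (fun e => hne (by rw [e])) hx hx').symm⟩
    by_cases e₂ : u = z
    · subst e₂
      rw [segment_symm] at hx'
      exact ⟨u, by simp, by simp, (n₃ u v w x huv hwz.symm
        (fun e => hne (by rw [e, Sym2.eq_swap])) hx hx').symm⟩
    by_cases e₃ : v = w
    · subst e₃
      rw [segment_symm] at hx
      exact ⟨v, by simp, by simp, (n₃ v u z x huv.symm hwz
        (fun e => hne (by rw [e, Sym2.eq_swap])) hx hx').symm⟩
    by_cases e₄ : v = z
    · subst e₄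
      rw [segment_symm] at hx hx'
      exact ⟨v, by simp, by simp, (n₃ v u w x huv.symm hwz.symm
        (fun e => hne (by rw [e])) hx hx').symm⟩
    exact absurd hx' (n₂ u v w z x huv hwz e₁ e₂ e₃ e₄ hx)

/-! ### Extremal graphs -/

/-- There is a graph with `n` vertices and `e` edges that has a straight-line drawing and does not
contain the double star `S₂₄`. -/
def ExistsStraightFree (n e : ℕ) : Prop :=
  ∃ (V : Type) (_ : Fintype V) (G : SimpleGraph V) (f : V → ℝ × ℝ), Fintype.card V = n ∧
    IsStraightDrawing G f ∧ (doubleStar 2 4).Free G ∧ G.edgeSet.ncard = e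

theorem doubleStar_free_sum {V W : Type*} {G : SimpleGraph V} {H : SimpleGraph W} {k l : ℕ}
    (hG : (doubleStar k l).Free G) (hH : (doubleStar k l).Free H) :
    (doubleStar k l).Free (G ⊕g H) := by
  intro h
  obtain ⟨u, v, a, b, huv, ha, hb, ia, ib, hav, hbu, hab⟩ := doubleStar_isContained_iff.1 h
  rcases u with u | u <;> rcases v with v | v
  · have ha' : ∀ i, ∃ x, a i = .inl x := fun i => by
      have := ha i
      rcases e : a i with x | x
      · exact ⟨x, rfl⟩
      · simp [e] at this
    have hb' : ∀ i, ∃ x, b i = .inl x := fun i => by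
      have := hb i
      rcases e : b i with x | x
      · exact ⟨x, rfl⟩
      · simp [e] at this
    choose a' ha' using ha'
    choose b' hb' using hb'
    obtain rfl : a = fun i => .inl (a' i) := funext ha'
    obtain rfl : b = fun i => .inl (b' i) := funext hb'
    exact hG (doubleStar_isContained_iff.2 ⟨u, v, a', b', by simpa using huv, by simpa using ha,
      by simpa using hb, fun i j e => ia (congrArg Sum.inl e), fun i j e => ib (congrArg Sum.inl e),
      by simpa using hav, by simpa using hbu, by simpa using hab⟩)
  · simp at huv
  · simp at huv
  · have ha' : ∀ i, ∃ x, a i = .inr x := fun i => by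
      have := ha i
      rcases e : a i with x | x
      · simp [e] at this
      · exact ⟨x, rfl⟩
    have hb' : ∀ i, ∃ x, b i = .inr x := fun i => by
      have := hb i
      rcases e : b i with x | x
      · simp [e] at this
      · exact ⟨x, rfl⟩
    choose a' ha' using ha'
    choose b' hb' using hb'
    obtain rfl : a = fun i => .inr (a' i) := funext ha'
    obtain rfl : b = fun i => .inr (b' i) := funext hb'
    exact hH (doubleStar_isContained_iff.2 ⟨u, v, a', b', by simpa using huv, by simpa using ha,
      by simpa using hb, fun i j e => ia (congrArg Sum.inr e), fun i j e => ib (congrArg Sum.inr e),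
      by simpa using hav, by simpa using hbu, by simpa using hab⟩)

theorem ExistsStraightFree.add {n m e e' : ℕ} (h : ExistsStraightFree n e)
    (h' : ExistsStraightFree m e') : ExistsStraightFree (n + m) (e + e') := by
  obtain ⟨V, _, G, f, rfl, hf, hG, rfl⟩ := h
  obtain ⟨W, _, H, g, rfl, hg, hH, rfl⟩ := h'
  obtain ⟨k, hk⟩ := hf.exists_sum hg
  refine ⟨V ⊕ W, inferInstance, G ⊕g H, k, Fintype.card_sum, hk, doubleStar_free_sum hG hH, ?_⟩
  rw [← Nat.card_coe_set_eq, ← Nat.card_coe_set_eq, ← Nat.card_coe_set_eq,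
    Nat.card_congr SimpleGraph.edgeSetSumEquiv, Nat.card_sum]

theorem existsStraightFree_zero : ExistsStraightFree 0 0 := by
  refine ⟨Fin 0, inferInstance, ⊥, fun v => v.elim0, rfl, ⟨fun v => v.elim0, fun {u} => u.elim0,
    fun {u} => u.elim0⟩, ?_, by simp⟩
  rintro ⟨f⟩
  exact (f (.inl none)).elim0

theorem ExistsStraightFree.mul {n e : ℕ} (h : ExistsStraightFree n e) (k : ℕ) :
    ExistsStraightFree (n * k) (e * k) := by
  induction k with
  | zero => exact existsStraightFree_zero
  | succ k ih => exact ih.add h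

theorem ExistsStraightFree.exists_fin {n e : ℕ} (h : ExistsStraightFree n e) :
    ∃ G : SimpleGraph (Fin n), IsPlanarGraph G ∧ (doubleStar 2 4).Free G ∧ G.edgeSet.ncard = e := by
  obtain ⟨V, _, G, f, hn, hf, hG, rfl⟩ := h
  let φ : Fin n ≃ V := (Fintype.equivFinOfCardEq hn).symm
  let iso : G.comap φ ≃g G := SimpleGraph.Iso.comap φ G
  refine ⟨G.comap φ, (hf.comap φ.toEmbedding).isPlanarGraph,
    fun h => hG (h.trans ⟨iso.toCopy⟩), ?_⟩
  rw [← Nat.card_coe_set_eq, ← Nat.card_coe_set_eq]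
  exact Nat.card_congr iso.mapEdgeSet

/-- The graph with the given lists of neighbours. -/
def graphOfLists {V : Type*} (nb : V → List V) (hs : ∀ u, ∀ v ∈ nb u, u ∈ nb v)
    (hl : ∀ u, u ∉ nb u) : SimpleGraph V where
  Adj u v := v ∈ nb u
  symm := ⟨hs⟩
  loopless := ⟨hl⟩

/-- The centre `v` with four leaves needs degree at least five. At degree exactly five all its
neighbours are used up, so both leaves of `u` lie outside the closed neighbourhood of `v`. -/
theorem graphOfLists_free {V : Type*} [DecidableEq V] (nb : V → List V)
    (hs : ∀ u, ∀ v ∈ nb u, u ∈ nb v) (hl : ∀ u, u ∉ nb u)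
    (h : ∀ u, ∀ v ∈ nb u, (nb v).length ≤ 4 ∨ (nb v).length = 5 ∧
      ((nb u).filter fun x => x ≠ v ∧ x ∉ nb v).length ≤ 1) :
    (doubleStar 2 4).Free (graphOfLists nb hs hl) := by
  intro hc
  obtain ⟨u, v, a, b, huv, ha, hb, ia, ib, hav, hbu, hab⟩ := doubleStar_isContained_iff.1 hc
  have hsub : insert u (Finset.univ.image b) ⊆ (nb v).toFinset := by
    intro x hx
    simp only [Finset.mem_insert, Finset.mem_image, Finset.mem_univ, true_and] at hx
    rw [List.mem_toFinset]
    rcases hx with rfl | ⟨j, rfl⟩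
    exacts [hs _ _ huv, hb j]
  have hcard : (insert u (Finset.univ.image b)).card = 5 := by
    rw [Finset.card_insert_of_notMem (by simpa using hbu), Finset.card_image_of_injective _ ib]
    simp
  have hle := Finset.card_le_card hsub
  have hlen := (nb v).toFinset_card_le
  rcases h u v huv with h' | ⟨h', h''⟩
  · omega
  · have heq := Finset.eq_of_subset_of_card_le hsub (by omega)
    have hsub' : Finset.univ.image a ⊆ ((nb u).filter fun x => x ≠ v ∧ x ∉ nb v).toFinset := by
      intro x hx
      obtain ⟨i, -, rfl⟩ := Finset.mem_image.1 hx
      rw [List.mem_toFinset, List.mem_filter]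
      refine ⟨ha i, ?_⟩
      rw [decide_eq_true_eq, ← List.mem_toFinset, ← heq]
      simp only [Finset.mem_insert, Finset.mem_image, Finset.mem_univ, true_and, not_or]
      exact ⟨hav i, (SimpleGraph.ne_of_adj _ (ha i)).symm, fun ⟨j, hj⟩ => hab i j hj.symm⟩
    have h₁ := Finset.card_le_card hsub'
    have h₂ := ((nb u).filter fun x => x ≠ v ∧ x ∉ nb v).toFinset_card_le
    rw [Finset.card_image_of_injective _ ia, Finset.card_univ, Fintype.card_fin] at h₁
    omega

theorem two_mul_ncard_edgeSet_graphOfLists {V : Type*} [Fintype V] [DecidableEq V]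
    (nb : V → List V) (hs : ∀ u, ∀ v ∈ nb u, u ∈ nb v) (hl : ∀ u, u ∉ nb u)
    (hnd : ∀ u, (nb u).Nodup) :
    2 * (graphOfLists nb hs hl).edgeSet.ncard = ∑ v, (nb v).length := by
  classical
  rw [← SimpleGraph.coe_edgeFinset, Set.ncard_coe_finset,
    ← SimpleGraph.sum_degrees_eq_twice_card_edges]
  refine Finset.sum_congr rfl fun v _ => ?_
  rw [← List.toFinset_card_of_nodup (hnd v), ← SimpleGraph.card_neighborFinset_eq_degree]
  congr 1
  ext w
  rw [SimpleGraph.mem_neighborFinset, List.mem_toFinset]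
  rfl

theorem existsStraightFree_of_lists {n e : ℕ} (nb : Fin n → List (Fin n)) (f : Fin n → ℤ × ℤ)
    (hs : ∀ u, ∀ v ∈ nb u, u ∈ nb v) (hl : ∀ u, u ∉ nb u) (hnd : ∀ u, (nb u).Nodup)
    (he : ∑ v, (nb v).length = 2 * e)
    (h : ∀ u, ∀ v ∈ nb u, (nb v).length ≤ 4 ∨ (nb v).length = 5 ∧
      ((nb u).filter fun x => x ≠ v ∧ x ∉ nb v).length ≤ 1)
    (hinj : ∀ u v, f u = f v → u = v)
    (h₁ : ∀ u, ∀ v ∈ nb u, u < v → ∀ w, w = u ∨ w = v ∨ latticeOrient (f u) (f v) (f w) ≠ 0)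
    (h₂ : ∀ u, ∀ v ∈ nb u, u < v → ∀ w, ∀ z ∈ nb w, w < z → u = w ∨ u = z ∨ v = w ∨ v = z ∨
      0 < latticeOrient (f u) (f v) (f w) * latticeOrient (f u) (f v) (f z) ∨
      0 < latticeOrient (f w) (f z) (f u) * latticeOrient (f w) (f z) (f v)) :
    ExistsStraightFree n e :=
  ⟨Fin n, inferInstance, graphOfLists nb hs hl, _, Fintype.card_fin n,
    isStraightDrawing_of_lattice f hinj h₁ h₂, graphOfLists_free nb hs hl h, by
      have := two_mul_ncard_edgeSet_graphOfLists nb hs hl hnd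
      omega⟩

/-- Two octahedra with a vertex inserted into a face, with an edge between these vertices. -/
theorem existsStraightFree_fourteen : ExistsStraightFree 14 31 := by
  -- The inserted vertices are 0 and 7. Integer coordinates make every condition decidable.
  refine existsStraightFree_of_lists
    ![[1, 2, 3, 7], [0, 2, 3, 5, 6], [0, 1, 3, 4, 6], [0, 1, 2, 4, 5], [2, 3, 5, 6], [1, 3, 4, 6],
      [1, 2, 4, 5], [0, 8, 9, 10], [7, 9, 10, 12, 13], [7, 8, 10, 11, 13], [7, 8, 9, 11, 12],
      [9, 10, 12, 13], [8, 10, 11, 13], [8, 9, 11, 12]]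
    ![(40, 0), (0, -17), (0, 17), (14, 1), (5, 4), (5, -3), (2, 0), (47, -3), (87, -20), (87, 14),
      (73, -2), (82, 1), (82, -6), (85, -3)] ?_ ?_ ?_ ?_ ?_ ?_ ?_ ?_
  all_goals decide +kernel

/-- Three octahedra with a vertex inserted into a face, and one more vertex adjacent to these. -/
theorem existsStraightFree_twentyTwo : ExistsStraightFree 22 48 := by
  -- The inserted vertices are 0, 7 and 14; vertex 21 joins them.
  refine existsStraightFree_of_lists
    ![[1, 2, 3, 21], [0, 2, 3, 5, 6], [0, 1, 3, 4, 6], [0, 1, 2, 4, 5], [2, 3, 5, 6], [1, 3, 4, 6],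
      [1, 2, 4, 5], [8, 9, 10, 21], [7, 9, 10, 12, 13], [7, 8, 10, 11, 13], [7, 8, 9, 11, 12],
      [9, 10, 12, 13], [8, 10, 11, 13], [8, 9, 11, 12], [15, 16, 17, 21], [14, 16, 17, 19, 20],
      [14, 15, 17, 18, 20], [14, 15, 16, 18, 19], [16, 17, 19, 20], [15, 17, 18, 20],
      [15, 16, 18, 19], [0, 7, 14]]
    ![(-5, -1), (-43, -22), (-47, 11), (-31, -3), (-40, -1), (-39, -8), (-43, -5), (3, -4),
      (41, -26), (14, -46), (18, -25), (21, -34), (26, -30), (26, -34), (2, 5), (2, 48), (33, 35),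
      (13, 28), (19, 35), (13, 38), (17, 40), (0, 0)] ?_ ?_ ?_ ?_ ?_ ?_ ?_ ?_
  all_goals decide +kernel

theorem theorem1 :
    (∀ (V : Type*) [Fintype V] (G : SimpleGraph V),
      IsPlanarGraph G → (doubleStar 2 4).Free G →
        (G.edgeSet.ncard : ℝ) ≤ 31 / 14 * (Fintype.card V : ℝ)) ∧
    (∀ n : ℕ, 14 ∣ n →
      ∃ G : SimpleGraph (Fin n), IsPlanarGraph G ∧ (doubleStar 2 4).Free G ∧
        (G.edgeSet.ncard : ℝ) = 31 / 14 * (n : ℝ)) ∧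
    (∀ n : ℕ, 14 ≤ n → n % 14 = 8 →
      ∃ G : SimpleGraph (Fin n), IsPlanarGraph G ∧ (doubleStar 2 4).Free G ∧
        G.edgeSet.ncard = ⌊(31 / 14 : ℝ) * (n : ℝ)⌋₊) := by
  refine ⟨fun V _ G hG hF => SimpleGraph.ncard_edgeSet_le G hG hF, ?_, ?_⟩
  · rintro n ⟨k, rfl⟩
    obtain ⟨G, hG, hF, he⟩ := (existsStraightFree_fourteen.mul k).exists_fin
    refine ⟨G, hG, hF, ?_⟩
    rw [he]
    push_cast
    ring
  · intro n hn hmod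
    -- As `n = 8` is excluded, `n` is at least 22. The bound is then `48 + 31 * k + 5 / 7`.
    obtain ⟨k, rfl⟩ : ∃ k, n = 22 + 14 * k := ⟨(n - 22) / 14, by omega⟩
    obtain ⟨G, hG, hF, he⟩ :=
      (existsStraightFree_twentyTwo.add (existsStraightFree_fourteen.mul k)).exists_fin
    refine ⟨G, hG, hF, ?_⟩
    rw [he]
    symm
    rw [Nat.floor_eq_iff (by positivity)]
    push_cast
    constructor <;> linarith
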